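/- **Theorem (linear rough differential equations: existence and uniqueness).** Let $p\in[2,3)$, $T>0$, and let $n,d$ be nonnegative integers. For a function $R$ of two times $0\le s\le t\le T$ and $q\ge1$ write $\|R\|_q=\big(\sup_\pi\sum_{[s,t]\in\pi}\|R_{s,t}\|^q\big)^{1/q}$, the supremum being over all partitions $\pi$ of $[0,T]$; for a path $Y$ on $[0,T]$ put $Y_{s,t}=Y_t-Y_s$ and $\|Y\|_q=\|(Y_{s,t})\|_q$, and let $\mathcal C^p$ be the set of continuous paths $Y$ on $[0,T]$ with $\|Y\|_p<\infty$. Let $\mathbf X=(X,\mathbb X)$ be a continuous $p$-rough path, i.e. $X\in\mathcal C^p([0,T],\mathbb R^d)$ and $\mathbb X:[0,T]^2\to\mathbb R^{d\times d}$ is continuous with $\|\mathbb X\|_{p/2}<\infty$ and $\mathbb X^{ij}_{s,t}=\mathbb X^{ij}_{s,r}+\mathbb X^{ij}_{r,t}+X^i_{s,r}X^j_{r,t}$ for all $1\le i,j\le d$ and $s,r,t\in[0,T]$ ($\mathbf X$ need not be geometric). For a finite-dimensional space $F$ let $\mathscr D^p_X([0,T],F)$ be the set of controlled paths, i.e. pairs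 $(Y,Y')\in\mathcal C^p([0,T],F)\times\mathcal C^p([0,T],\mathcal L(\mathbb R^d,F))$ whose remainder $R^Y_{s,t}=Y_{s,t}-Y'_sX_{s,t}$ satisfies $\|R^Y\|_{p/2}<\infty$. For $Y$ with values in $\mathcal L(\mathbb R^d,\mathbb R^n)$ and Gubinelli derivative $Y'$, the rough integral is $$\int_0^tY_r\,d\mathbf X_r=\lim_{|\pi|\to0}\sum_{[r,s]\in\pi}\big(Y_rX_{r,s}+Y'_r\mathbb X_{r,s}\big),\qquad Y'_r\mathbb X_{r,s}=\sum_{i,j=1}^d\mathbb X^{ij}_{r,s}\,Y'_r(e_i)(e_j),$$ the limit being over partitions $\pi$ of $[0,t]$ with mesh $|\pi|$ tending to $0$. Let $v\in\mathbb R^n$, $A\in L^\infty([0,T],\mathbb R^{n\times n})$, and $(\Sigma,\Sigma')\in\mathscr D^p_X([0,T],\mathbb R^{n\times d\times n})$, where $\mathbb R^{n\times d\times n}\cong\mathcal L(\mathbb R^n,\mathcal L(\mathbb R^d,\mathbb R^n))$. Then there is exactly one $(V,V')\in\mathscr D^p_X([0,T],\mathbb R^n)$ with $V'=\Sigma V$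 on $[0,T]$ such that $$V_t=v+\int_0^tA_sV_s\,ds+\int_0^t\Sigma_sV_s\,d\mathbf X_s\qquad\text{for all }t\in[0,T],$$ where the rough integral exists and is formed with the Gubinelli derivative $(\Sigma V)'=\Sigma V'+\Sigma'V$ of $\Sigma V$, that is, $(\Sigma V)'_s(x)=\Sigma_s(V'_sx)+\Sigma'_s(x)V_s$ for $x\in\mathbb R^d$. -/

import Mathlib

open MeasureTheory Set
open scoped ENNReal

/-- A partition `a = pt 0 ≤ pt 1 ≤ ⋯ ≤ pt n = b` of the interval `[a, b]`; the values `pt i` with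
`i > n` are irrelevant. Repeated points are allowed: the quantities summed over partitions below
(increments of paths, enhancements of rough paths, remainders of controlled paths) vanish on
intervals of length zero, so this changes neither suprema nor limits over partitions. -/
structure IntervalPartition (a b : ℝ) where
  n : ℕ
  pt : ℕ → ℝ
  first : pt 0 = a
  last : pt n = b
  mono : ∀ i < n, pt i ≤ pt (i + 1)

/-- The `q`-variation over `[a, b]` of a function `R` of two times,
`(sup_π ∑_{[u, v] ∈ π} ‖R u v‖ ^ q) ^ (1 / q)`, with value in `[0, ∞]`. -/
noncomputable def pVariation {F : Type*} [NormedAddCommGroup F]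
    (q : ℝ) (R : ℝ → ℝ → F) (a b : ℝ) : ℝ≥0∞ :=
  (⨆ π : IntervalPartition a b,
    ∑ i ∈ Finset.range π.n, ‖R (π.pt i) (π.pt (i + 1))‖ₑ ^ q) ^ (1 / q)

/-- The increments `Y_{s,t} = Y_t - Y_s` of a path. -/
def pathIncrement {F : Type*} [NormedAddCommGroup F] (Y : ℝ → F) (s t : ℝ) : F := Y t - Y s

/-- Continuous paths `[0, T] → F` of finite `p`-variation. Paths are represented by functions
on `ℝ`, of which only the restriction to `[0, T]` matters. -/
structure IsVariationPath {F : Type*} [NormedAddCommGroup F]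
    (p T : ℝ) (Y : ℝ → F) : Prop where
  continuousOn : ContinuousOn Y (Icc 0 T)
  finite : pVariation p (pathIncrement Y) 0 T < ∞

/-- `(X, XX)` is a (continuous, not necessarily geometric) rough path of finite `p`-variation on
`[0, T]` with values in `ℝ^d`; `XX s t (i, j)` plays the role of `∫_s^t X^i_{s,r} dX^j_r`. -/
structure IsRoughPath {d : ℕ} (p T : ℝ) (X : ℝ → EuclideanSpace ℝ (Fin d))
    (XX : ℝ → ℝ → EuclideanSpace ℝ (Fin d × Fin d)) : Prop where
  path : IsVariationPath p T X
  continuousOn : ContinuousOn (fun z : ℝ × ℝ => XX z.1 z.2) (Icc 0 T ×ˢ Icc 0 T)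
  chen : ∀ s ∈ Icc 0 T, ∀ r ∈ Icc 0 T, ∀ t ∈ Icc 0 T, ∀ i j : Fin d,
    XX s t (i, j) = XX s r (i, j) + XX r t (i, j) + (X r i - X s i) * (X t j - X r j)
  finite : pVariation (p / 2) XX 0 T < ∞

/-- The remainder `R^Y_{s,t} = Y_{s,t} - Y'_s X_{s,t}`. -/
noncomputable def controlledRemainder {d : ℕ} {F : Type*} [NormedAddCommGroup F] [NormedSpace ℝ F]
    (X : ℝ → EuclideanSpace ℝ (Fin d)) (Y : ℝ → F) (Y' : ℝ → EuclideanSpace ℝ (Fin d) →L[ℝ] F)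
    (s t : ℝ) : F :=
  pathIncrement Y s t - Y' s (pathIncrement X s t)

/-- `(Y, Y')` is a path on `[0, T]` controlled by `X`, with values in `F`. -/
structure IsControlledPath {d : ℕ} {F : Type*} [NormedAddCommGroup F] [NormedSpace ℝ F]
    (p T : ℝ) (X : ℝ → EuclideanSpace ℝ (Fin d)) (Y : ℝ → F)
    (Y' : ℝ → EuclideanSpace ℝ (Fin d) →L[ℝ] F) : Prop where
  path : IsVariationPath p T Y
  deriv : IsVariationPath p T Y'
  remainder : pVariation (p / 2) (controlledRemainder X Y Y') 0 T < ∞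

/-- The action `∑_{i,j} M^{ij} B(e_i, e_j)` on `M ∈ ℝ^{d × d}` of a bilinear map `B`, through
`L(ℝ^d, L(ℝ^d, F)) ≅ L(ℝ^{d × d}, F)`. -/
noncomputable def bilinearContract {d : ℕ} {F : Type*} [NormedAddCommGroup F] [NormedSpace ℝ F]
    (B : EuclideanSpace ℝ (Fin d) →L[ℝ] EuclideanSpace ℝ (Fin d) →L[ℝ] F)
    (M : EuclideanSpace ℝ (Fin d × Fin d)) : F :=
  ∑ i : Fin d, ∑ j : Fin d,
    M (i, j) • B (EuclideanSpace.single i (1 : ℝ)) (EuclideanSpace.single j (1 : ℝ))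

/-- The rough integral `∫_a^b Y_r d𝐗_r` exists and equals `I`: the compensated Riemann sums
`∑_{[s, t] ∈ π} (Y_s X_{s,t} + Y'_s XX_{s,t})` over the partitions `π` of `[a, b]` converge to `I`
as the mesh of `π` tends to `0`. -/
def HasRoughIntegral {d : ℕ} {F : Type*} [NormedAddCommGroup F] [NormedSpace ℝ F]
    (X : ℝ → EuclideanSpace ℝ (Fin d)) (XX : ℝ → ℝ → EuclideanSpace ℝ (Fin d × Fin d))
    (Y : ℝ → EuclideanSpace ℝ (Fin d) →L[ℝ] F)
    (Y' : ℝ → EuclideanSpace ℝ (Fin d) →L[ℝ] EuclideanSpace ℝ (Fin d) →L[ℝ] F)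
    (a b : ℝ) (I : F) : Prop :=
  ∀ ε > 0, ∃ δ > 0, ∀ π : IntervalPartition a b,
    (∀ i < π.n, π.pt (i + 1) - π.pt i < δ) →
    ‖(∑ i ∈ Finset.range π.n,
        (Y (π.pt i) (pathIncrement X (π.pt i) (π.pt (i + 1))) +
          bilinearContract (Y' (π.pt i)) (XX (π.pt i) (π.pt (i + 1))))) - I‖ < ε

/-- The product path `(S V)_t = S_t V_t`, where `S_t ∈ ℝ^{n × d × n} ≅ L(ℝ^n, L(ℝ^d, ℝ^n))`. -/
noncomputable def prodPath {n d : ℕ}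
    (S : ℝ → EuclideanSpace ℝ (Fin n) →L[ℝ]
      EuclideanSpace ℝ (Fin d) →L[ℝ] EuclideanSpace ℝ (Fin n))
    (V : ℝ → EuclideanSpace ℝ (Fin n)) (t : ℝ) :
    EuclideanSpace ℝ (Fin d) →L[ℝ] EuclideanSpace ℝ (Fin n) :=
  S t (V t)

/-- The Gubinelli derivative `(S V)'_t = S'_t V_t + S_t V'_t` of the product path: in the direction
`x` it is `S'_t(x) V_t + S_t (V'_t x)`. -/
noncomputable def prodPathDeriv {n d : ℕ}
    (S : ℝ → EuclideanSpace ℝ (Fin n) →L[ℝ]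
      EuclideanSpace ℝ (Fin d) →L[ℝ] EuclideanSpace ℝ (Fin n))
    (S' : ℝ → EuclideanSpace ℝ (Fin d) →L[ℝ] EuclideanSpace ℝ (Fin n) →L[ℝ]
      EuclideanSpace ℝ (Fin d) →L[ℝ] EuclideanSpace ℝ (Fin n))
    (V : ℝ → EuclideanSpace ℝ (Fin n))
    (V' : ℝ → EuclideanSpace ℝ (Fin d) →L[ℝ] EuclideanSpace ℝ (Fin n)) (t : ℝ) :
    EuclideanSpace ℝ (Fin d) →L[ℝ] EuclideanSpace ℝ (Fin d) →L[ℝ] EuclideanSpace ℝ (Fin n) :=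
  (S' t).flip (V t) + (S t).comp (V' t)

/-- `(V, V')` is a controlled path with `V' = S V` on `[0, T]` that solves
`V_t = v + ∫_0^t A_s V_s ds + ∫_0^t S_s V_s d𝐗_s` for all `t ∈ [0, T]`. -/
structure IsLinearRDESolution {n d : ℕ} (p T : ℝ) (v : EuclideanSpace ℝ (Fin n))
    (A : ℝ → EuclideanSpace ℝ (Fin n) →L[ℝ] EuclideanSpace ℝ (Fin n))
    (X : ℝ → EuclideanSpace ℝ (Fin d)) (XX : ℝ → ℝ → EuclideanSpace ℝ (Fin d × Fin d))
    (S : ℝ → EuclideanSpace ℝ (Fin n) →L[ℝ]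
      EuclideanSpace ℝ (Fin d) →L[ℝ] EuclideanSpace ℝ (Fin n))
    (S' : ℝ → EuclideanSpace ℝ (Fin d) →L[ℝ] EuclideanSpace ℝ (Fin n) →L[ℝ]
      EuclideanSpace ℝ (Fin d) →L[ℝ] EuclideanSpace ℝ (Fin n))
    (V : ℝ → EuclideanSpace ℝ (Fin n))
    (V' : ℝ → EuclideanSpace ℝ (Fin d) →L[ℝ] EuclideanSpace ℝ (Fin n)) : Prop where
  controlled : IsControlledPath p T X V V'
  deriv_eq : ∀ t ∈ Icc 0 T, V' t = prodPath S V t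
  equation : ∀ t ∈ Icc 0 T, ∃ I : EuclideanSpace ℝ (Fin n),
    HasRoughIntegral X XX (prodPath S V) (prodPathDeriv S S' V V') 0 t I ∧
      V t = v + (∫ s in (0 : ℝ)..t, A s (V s)) + I

/-! ### Superadditive functions and controls -/

/-! The equation is linear, so over a short interval a solution is, up to a small error, the image
of its initial value under the one-step map `rdeStep`, J_{s,t} = 1 + ∫_s^t A + S_s X_{s,t} + (S'_s +
S_s S_s) XX_{s,t}, a bounded operator on ℝ^n. By Chen's relation and the expansion of S along X, all
terms of order one and two cancel in J_{r,t} J_{s,r} - J_{s,t} (`roughStep_defect`). For q in (p, 3)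
and a suitable control w this leaves an error of size w(s,t)^(3/q), and the exponent exceeds one.
Passing from p to q > p makes it easy to find controls that are small near the diagonal: no
continuity of the p-variation itself is needed.

Multiplicative sewing (`exists_bound`, `exists_global_bound`) then shows that products of J along
arbitrary sequences of times are uniformly bounded and differ from the single factor J by at most K
w^(3/q).

Existence: on a finite set of times, applying these products to v gives a path with |Y_t - J_{s,t}
Y_s| ≤ C w(s,t)^(3/q), with constants independent of the set. Compactness yields a path on all of
[0, T] with the same bound. Summed over a partition, the bound says that the compensated Riemann
sums converge to the right limit. The bound also yields the controlled structure; p-variation,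
rather than q-variation, is recovered by returning to the given data.

Uniqueness: by additive sewing every solution satisfies a bound of the same kind
(`norm_solution_sub_step_le`), and by linearity so does the difference D of two solutions, with D_0
= 0. Telescoping through the bounded products gives |D_t| ≤ M C ∑ w^(3/q), which tends to 0 with the
mesh. -/

/-- A nonnegative function of two times that is superadditive on `[0, T]`. -/
structure IsSuperadditive (T : ℝ) (w : ℝ → ℝ → ℝ) : Prop where
  nonneg : ∀ s t, 0 ≤ w s t
  add_le : ∀ ⦃s r t⦄, 0 ≤ s → s ≤ r → r ≤ t → t ≤ T → w s r + w r t ≤ w s t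

/-- A superadditive function which is uniformly small near the diagonal. -/
structure IsControl (T : ℝ) (w : ℝ → ℝ → ℝ) : Prop extends IsSuperadditive T w where
  small : ∀ ε > 0, ∃ δ > 0, ∀ s t, 0 ≤ s → s ≤ t → t ≤ T → t - s < δ → w s t < ε

namespace IsSuperadditive

variable {T : ℝ} {w w' : ℝ → ℝ → ℝ}

theorem add (hw : IsSuperadditive T w) (hw' : IsSuperadditive T w') :
    IsSuperadditive T (fun s t => w s t + w' s t) where
  nonneg s t := add_nonneg (hw.nonneg s t) (hw'.nonneg s t)
  add_le s r t h1 h2 h3 h4 := by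
    have := hw.add_le h1 h2 h3 h4
    have := hw'.add_le h1 h2 h3 h4
    linarith

theorem mono (hw : IsSuperadditive T w) {s s' t' t : ℝ} (h0 : 0 ≤ s) (h1 : s ≤ s') (h2 : s' ≤ t')
    (h3 : t' ≤ t) (h4 : t ≤ T) : w s' t' ≤ w s t := by
  have h5 := hw.add_le h0 h1 (h2.trans h3) h4
  have h6 := hw.add_le (h0.trans h1) h2 h3 h4
  have := hw.nonneg s s'
  have := hw.nonneg t' t
  linarith

theorem self (hw : IsSuperadditive T w) {s : ℝ} (h0 : 0 ≤ s) (h1 : s ≤ T) : w s s = 0 := by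
  have := hw.add_le h0 le_rfl le_rfl h1
  have := hw.nonneg s s
  linarith

theorem sum_le (hw : IsSuperadditive T w) {t : ℕ → ℝ} (ht : Monotone t)
    (hm : ∀ k, t k ∈ Icc 0 T) (N : ℕ) :
    ∑ i ∈ Finset.range N, w (t i) (t (i + 1)) ≤ w (t 0) (t N) := by
  induction N with
  | zero => simpa using hw.nonneg _ _
  | succ N ih =>
    rw [Finset.sum_range_succ]
    have := hw.add_le (hm 0).1 (ht (Nat.zero_le N)) (ht (Nat.le_succ N)) (hm (N + 1)).2
    linarith

/-- Along a sequence of times there is an interval both of whose complementary parts carry at most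
half of the total mass. -/
theorem exists_split (hw : IsSuperadditive T w) {t : ℕ → ℝ} (ht : Monotone t)
    (hm : ∀ k, t k ∈ Icc 0 T) (i m : ℕ) (c : ℝ) (hc : 0 ≤ c) :
    w (t i) (t (i + m)) ≤ c ∨ ∃ k l, m = k + 1 + l ∧ w (t i) (t (i + k)) ≤ c ∧
      w (t (i + (k + 1))) (t (i + (k + 1) + l)) ≤ w (t i) (t (i + m)) - c := by
  by_cases h : w (t i) (t (i + m)) ≤ c
  · exact Or.inl h
  right
  -- Stop at the first index where the mass from the left exceeds `c`. The interval that crosses the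
  -- level is left out of both parts, because it alone may carry a large mass.
  have hex : ∃ k, c < w (t i) (t (i + k)) := ⟨m, not_le.1 h⟩
  classical
  have hspec := Nat.find_spec hex
  have hmin : ∀ k, k < Nat.find hex → w (t i) (t (i + k)) ≤ c :=
    fun k hk => not_lt.1 (Nat.find_min hex hk)
  have hle : Nat.find hex ≤ m := Nat.find_min' hex (not_le.1 h)
  have hne : Nat.find hex ≠ 0 := by
    intro h0
    rw [h0, add_zero, hw.self (hm i).1 (hm i).2] at hspec
    linarith
  obtain ⟨k, hk⟩ := Nat.exists_eq_succ_of_ne_zero hne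
  rw [hk] at hspec hmin hle
  obtain ⟨l, hl⟩ := Nat.exists_eq_add_of_le hle
  refine ⟨k, l, hl, hmin k (Nat.lt_succ_self k), ?_⟩
  have hl' : i + m = i + (k + 1) + l := by omega
  have := hw.add_le (hm i).1 (ht (Nat.le_add_right i (k + 1)))
    (ht (Nat.le_add_right (i + (k + 1)) l)) (hm _).2
  rw [hl']
  simp only [Nat.succ_eq_add_one] at hspec
  linarith

theorem exists_split_half (hw : IsSuperadditive T w) {t : ℕ → ℝ} (ht : Monotone t)
    (hm : ∀ k, t k ∈ Icc 0 T) (i : ℕ) {m : ℕ} (hm0 : m ≠ 0) :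
    ∃ k l, m = k + 1 + l ∧ w (t i) (t (i + k)) ≤ w (t i) (t (i + m)) / 2 ∧
      w (t (i + (k + 1))) (t (i + (k + 1) + l)) ≤ w (t i) (t (i + m)) / 2 := by
  have hn := hw.nonneg (t i) (t (i + m))
  rcases hw.exists_split ht hm i m (w (t i) (t (i + m)) / 2) (by linarith) with h | h
  -- A mass at most half of itself is zero, so any splitting does.
  · have h0 : w (t i) (t (i + m)) = 0 := by linarith
    refine ⟨0, m - 1, by omega, ?_, ?_⟩
    · rw [add_zero, hw.self (hm i).1 (hm i).2]; linarith
    · refine (hw.mono (hm i).1 (ht ?_) (ht ?_) (ht ?_) (hm (i + m)).2).trans (by linarith) <;> omega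
  · obtain ⟨k, l, h1, h2, h3⟩ := h
    exact ⟨k, l, h1, h2, h3.trans (by linarith)⟩

end IsSuperadditive

namespace IsControl

variable {T : ℝ} {w w' : ℝ → ℝ → ℝ}

theorem add (hw : IsControl T w) (hw' : IsControl T w') :
    IsControl T (fun s t => w s t + w' s t) where
  toIsSuperadditive := hw.toIsSuperadditive.add hw'.toIsSuperadditive
  small ε hε := by
    obtain ⟨δ, hδ, h⟩ := hw.small (ε / 2) (by linarith)
    obtain ⟨δ', hδ', h'⟩ := hw'.small (ε / 2) (by linarith)
    refine ⟨min δ δ', lt_min hδ hδ', fun s t h1 h2 h3 h4 => ?_⟩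
    have := h s t h1 h2 h3 (h4.trans_le (min_le_left _ _))
    have := h' s t h1 h2 h3 (h4.trans_le (min_le_right _ _))
    linarith

theorem length (T : ℝ) : IsControl T (fun s t => |t - s|) where
  nonneg s t := abs_nonneg _
  add_le s r t h1 h2 h3 h4 := by
    rw [abs_of_nonneg (by linarith), abs_of_nonneg (by linarith), abs_of_nonneg (by linarith)]
    linarith
  small ε hε := ⟨ε, hε, fun s t h1 h2 h3 h4 => by rwa [abs_of_nonneg (by linarith)]⟩

/-- Sums of powers `w ^ θ`, `θ > 1`, of a control along sequences of small mesh are small. -/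
theorem sum_rpow_small (hw : IsControl T w) {θ : ℝ} (hθ : 1 < θ) (C : ℝ) {ε : ℝ}
    (hε : 0 < ε) :
    ∃ δ > 0, ∀ (t : ℕ → ℝ) (N : ℕ), Monotone t → (∀ k, t k ∈ Icc 0 T) →
      (∀ i < N, t (i + 1) - t i < δ) →
      ∑ i ∈ Finset.range N, C * w (t i) (t (i + 1)) ^ θ < ε := by
  have hw0 := hw.nonneg 0 T
  -- Of the θ factors of `w`, a power θ - 1 is made at most `ε / D` by the mesh and one full factor
  -- is kept for superadditivity. The two summands 1 in `D` keep it nonzero and make the final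
  -- inequality strict.
  set D := (|C| + 1) * (w 0 T + 1) with hD
  have hDpos : 0 < D := by positivity
  obtain ⟨δ, hδ, h⟩ := hw.small ((ε / D) ^ (1 / (θ - 1))) (by positivity)
  refine ⟨δ, hδ, fun t N ht hm hmesh => ?_⟩
  have hterm : ∀ i ∈ Finset.range N, C * w (t i) (t (i + 1)) ^ θ ≤
      |C| * (ε / D) * w (t i) (t (i + 1)) := by
    intro i hi
    have hn := hw.nonneg (t i) (t (i + 1))
    have h1 := h _ _ (hm i).1 (ht (Nat.le_succ i)) (hm (i + 1)).2 (hmesh i (Finset.mem_range.1 hi))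
    have h2 : w (t i) (t (i + 1)) ^ (θ - 1) ≤ ε / D := by
      calc _ ≤ ((ε / D) ^ (1 / (θ - 1))) ^ (θ - 1) :=
            Real.rpow_le_rpow hn h1.le (by linarith)
        _ = ε / D := by
            rw [← Real.rpow_mul (by positivity), one_div, inv_mul_cancel₀ (by linarith),
              Real.rpow_one]
    have h3 : w (t i) (t (i + 1)) ^ θ = w (t i) (t (i + 1)) ^ (θ - 1) * w (t i) (t (i + 1)) := by
      nth_rewrite 3 [← Real.rpow_one (w (t i) (t (i + 1)))]
      rw [← Real.rpow_add_of_nonneg hn (by linarith) zero_le_one]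
      congr 1; ring
    rw [h3]
    calc C * (w (t i) (t (i + 1)) ^ (θ - 1) * w (t i) (t (i + 1)))
        ≤ |C| * (w (t i) (t (i + 1)) ^ (θ - 1) * w (t i) (t (i + 1))) := by
          gcongr; exact le_abs_self C
      _ ≤ |C| * ((ε / D) * w (t i) (t (i + 1))) := by gcongr
      _ = _ := by ring
  calc _ ≤ ∑ i ∈ Finset.range N, |C| * (ε / D) * w (t i) (t (i + 1)) := Finset.sum_le_sum hterm
    _ = |C| * (ε / D) * ∑ i ∈ Finset.range N, w (t i) (t (i + 1)) := by rw [Finset.mul_sum]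
    _ ≤ |C| * (ε / D) * w 0 T := by
        gcongr
        exact (hw.sum_le ht hm N).trans
          (hw.mono le_rfl (hm 0).1 (ht (Nat.zero_le N)) (hm N).2 le_rfl)
    _ < (|C| + 1) * (ε / D) * (w 0 T + 1) := by
        have : 0 < ε / D := by positivity
        have := abs_nonneg C
        apply mul_lt_mul'' <;> first | positivity | nlinarith
    _ = ε := by rw [hD]; field_simp

end IsControl

theorem half_rpow {x : ℝ} (hx : 0 ≤ x) (θ : ℝ) : (x / 2) ^ θ = 2 ^ (-θ) * x ^ θ := by
  rw [Real.div_rpow hx zero_le_two, Real.rpow_neg zero_le_two]; ring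

/-! ### Additive and multiplicative sewing bounds -/

/-- Induction on the number of intervals. A split into two parts of at most half the mass and one
interval between them costs two defects, at most 2C W^θ, while each part contributes at most K
(W/2)^θ. Since 2 · 2^(-θ) < 1, the constant K solving K · 2^(1-θ) + 2C = K closes the induction,
whatever the number of points. -/
theorem norm_sum_sub_le_of_almost_additive {F : Type*} [NormedAddCommGroup F] {T θ C : ℝ}
    {w : ℝ → ℝ → ℝ} (hw : IsSuperadditive T w) (hθ : 1 < θ) (hC : 0 ≤ C) {Ξ : ℝ → ℝ → F}
    (hΞ0 : ∀ s ∈ Icc 0 T, Ξ s s = 0)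
    (hΞ : ∀ s r t, 0 ≤ s → s ≤ r → r ≤ t → t ≤ T →
      ‖Ξ s r + Ξ r t - Ξ s t‖ ≤ C * w s t ^ θ)
    {t : ℕ → ℝ} (ht : Monotone t) (hm : ∀ k, t k ∈ Icc 0 T) (m : ℕ) : ∀ i : ℕ,
    ‖(∑ k ∈ Finset.range m, Ξ (t (i + k)) (t (i + k + 1))) - Ξ (t i) (t (i + m))‖ ≤
      2 * C / (1 - 2 ^ (1 - θ)) * w (t i) (t (i + m)) ^ θ := by
  have hlt : (2 : ℝ) ^ (1 - θ) < 1 := Real.rpow_lt_one_of_one_lt_of_neg one_lt_two (by linarith)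
  set K := 2 * C / (1 - 2 ^ (1 - θ)) with hK
  have hK0 : 0 ≤ K := div_nonneg (by linarith) (by linarith)
  have hKeq : K * (2 * 2 ^ (-θ)) + 2 * C = K := by
    have h1 : (2 : ℝ) * 2 ^ (-θ) = 2 ^ (1 - θ) := by
      rw [sub_eq_add_neg, Real.rpow_add two_pos, Real.rpow_one]
    have h2 : 1 - (2 : ℝ) ^ (1 - θ) ≠ 0 := by linarith
    rw [h1, hK]; field_simp; ring
  induction m using Nat.strong_induction_on with
  | _ m ih =>
  intro i
  rcases eq_or_ne m 0 with rfl | hm0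
  · simp only [Finset.range_zero, Finset.sum_empty, add_zero, hΞ0 _ (hm i), sub_zero, norm_zero]
    exact mul_nonneg hK0 (Real.rpow_nonneg (hw.nonneg _ _) _)
  obtain ⟨k, l, hkl, hL, hR⟩ := hw.exists_split_half ht hm i hm0
  have hwn := hw.nonneg (t i) (t (i + m))
  set W := w (t i) (t (i + m)) with hW
  have him : i + m = i + (k + 1) + l := by omega
  have t1 : t i ≤ t (i + k) := ht (by omega)
  have t2 : t (i + k) ≤ t (i + (k + 1)) := ht (by omega)
  have t3 : t (i + (k + 1)) ≤ t (i + m) := ht (by omega)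
  have bL := (ih k (by omega) i).trans (mul_le_mul_of_nonneg_left
    (Real.rpow_le_rpow (hw.nonneg _ _) hL (by linarith)) hK0)
  have bR := (ih l (by omega) (i + (k + 1))).trans (mul_le_mul_of_nonneg_left
    (Real.rpow_le_rpow (hw.nonneg _ _) hR (by linarith)) hK0)
  rw [half_rpow hwn] at bL bR
  have e1 := hΞ _ _ _ (hm i).1 t1 t2 (hm (i + (k + 1))).2
  have e1' : ‖Ξ (t i) (t (i + k)) + Ξ (t (i + k)) (t (i + (k + 1))) - Ξ (t i) (t (i + (k + 1)))‖
      ≤ C * W ^ θ := e1.trans (mul_le_mul_of_nonneg_left (Real.rpow_le_rpow (hw.nonneg _ _)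
        (hw.mono (hm i).1 le_rfl (t1.trans t2) t3 (hm _).2) (by linarith)) hC)
  have e2 := hΞ _ _ _ (hm i).1 (t1.trans t2) t3 (hm (i + m)).2
  have hsum : ∑ j ∈ Finset.range m, Ξ (t (i + j)) (t (i + j + 1)) =
      (∑ j ∈ Finset.range k, Ξ (t (i + j)) (t (i + j + 1))) + Ξ (t (i + k)) (t (i + (k + 1))) +
      ∑ j ∈ Finset.range l, Ξ (t (i + (k + 1) + j)) (t (i + (k + 1) + j + 1)) := by
    rw [hkl, Finset.sum_range_add, Finset.sum_range_succ]
    simp only [add_assoc]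
  rw [hsum]
  rw [← him] at bR
  generalize (∑ j ∈ Finset.range k, Ξ (t (i + j)) (t (i + j + 1))) = SL at *
  generalize (∑ j ∈ Finset.range l, Ξ (t (i + (k + 1) + j)) (t (i + (k + 1) + j + 1))) = SR at *
  have hdec : SL + Ξ (t (i + k)) (t (i + (k + 1))) + SR - Ξ (t i) (t (i + m)) =
      (SL - Ξ (t i) (t (i + k))) + (SR - Ξ (t (i + (k + 1))) (t (i + m))) +
      (Ξ (t i) (t (i + k)) + Ξ (t (i + k)) (t (i + (k + 1))) - Ξ (t i) (t (i + (k + 1)))) +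
      (Ξ (t i) (t (i + (k + 1))) + Ξ (t (i + (k + 1))) (t (i + m)) - Ξ (t i) (t (i + m))) := by
    abel
  rw [hdec]
  refine norm_add₄_le.trans ?_
  calc _ ≤ K * (2 ^ (-θ) * W ^ θ) + K * (2 ^ (-θ) * W ^ θ) + C * W ^ θ + C * W ^ θ := by
        gcongr
    _ = (K * (2 * 2 ^ (-θ)) + 2 * C) * W ^ θ := by ring
    _ = K * W ^ θ := by rw [hKeq]

/-- A function `J` of two times with values in a normed ring which is multiplicative up to an error
controlled by `w ^ θ`. -/
structure IsAlmostMultiplicative {𝔸 : Type*} [NormedRing 𝔸] (T θ : ℝ) (w : ℝ → ℝ → ℝ)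
    (J : ℝ → ℝ → 𝔸) : Prop where
  self : ∀ s ∈ Icc 0 T, J s s = 1
  near_one : ∀ η > 0, ∃ c > 0, ∀ s t, 0 ≤ s → s ≤ t → t ≤ T → w s t ≤ c → ‖J s t‖ ≤ 1 + η
  bounded : ∃ B, ∀ s t, 0 ≤ s → s ≤ t → t ≤ T → ‖J s t‖ ≤ B
  mul : ∃ C, ∀ s r t, 0 ≤ s → s ≤ r → r ≤ t → t ≤ T → ‖J r t * J s r - J s t‖ ≤ C * w s t ^ θ

/-- The product `J (t (i + m - 1)) (t (i + m)) * ⋯ * J (t i) (t (i + 1))`. -/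
def seqProd {𝔸 : Type*} [NormedRing 𝔸] (J : ℝ → ℝ → 𝔸) (t : ℕ → ℝ) (i : ℕ) : ℕ → 𝔸
  | 0 => 1
  | m + 1 => J (t (i + m)) (t (i + m + 1)) * seqProd J t i m

theorem seqProd_add {𝔸 : Type*} [NormedRing 𝔸] (J : ℝ → ℝ → 𝔸) (t : ℕ → ℝ) (i m l : ℕ) :
    seqProd J t i (m + l) = seqProd J t (i + m) l * seqProd J t i m := by
  induction l with
  | zero => simp [seqProd]
  | succ l ih =>
    rw [← add_assoc, seqProd, ih, seqProd, mul_assoc]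
    simp only [add_assoc]

theorem seqProd_split {𝔸 : Type*} [NormedRing 𝔸] (J : ℝ → ℝ → 𝔸) (t : ℕ → ℝ) (i k l : ℕ) :
    seqProd J t i (k + 1 + l) = seqProd J t (i + (k + 1)) l *
      (J (t (i + k)) (t (i + (k + 1))) * seqProd J t i k) := by
  rw [seqProd_add, seqProd]; rfl

namespace IsAlmostMultiplicative

variable {𝔸 : Type*} [NormedRing 𝔸] {T θ : ℝ} {w : ℝ → ℝ → ℝ} {J : ℝ → ℝ → 𝔸}

/-- The halving induction of the additive case, except that errors are now multiplied by the
neighbouring factors. On pieces of mass at most `c` those factors have norm at most 1 + 2η, so the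
contraction constant becomes L = 2^(1-θ) (1 + 2η)^2, still below one for small η. This is why the
bound is first obtained only locally. -/
theorem exists_local_bound (hJ : IsAlmostMultiplicative T θ w J) (hw : IsSuperadditive T w)
    (hθ : 1 < θ) :
    ∃ c > 0, ∃ K ≥ 0, ∀ t : ℕ → ℝ, Monotone t → (∀ k, t k ∈ Icc 0 T) → ∀ m i : ℕ,
      w (t i) (t (i + m)) ≤ c →
      ‖seqProd J t i m - J (t i) (t (i + m))‖ ≤ K * w (t i) (t (i + m)) ^ θ := by
  obtain ⟨C', hC'⟩ := hJ.mul
  obtain ⟨C, hC0, hC⟩ : ∃ C ≥ 0, ∀ s r t, 0 ≤ s → s ≤ r → r ≤ t → t ≤ T →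
      ‖J r t * J s r - J s t‖ ≤ C * w s t ^ θ :=
    ⟨|C'|, abs_nonneg _, fun s r t h1 h2 h3 h4 => (hC' s r t h1 h2 h3 h4).trans
      (mul_le_mul_of_nonneg_right (le_abs_self _) (Real.rpow_nonneg (hw.nonneg _ _) _))⟩
  have h1 : (2 : ℝ) * 2 ^ (-θ) = 2 ^ (1 - θ) := by
    rw [sub_eq_add_neg, Real.rpow_add two_pos, Real.rpow_one]
  have hlt : (2 : ℝ) * 2 ^ (-θ) < 1 := by
    rw [h1]; exact Real.rpow_lt_one_of_one_lt_of_neg one_lt_two (by linarith)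
  have hz : (0 : ℝ) < 2 ^ (-θ) := by positivity
  obtain ⟨η, hη0, hη1, hη⟩ : ∃ η : ℝ, 0 < η ∧ η ≤ 1 ∧ 2 * 2 ^ (-θ) * (1 + 2 * η) ^ 2 < 1 := by
    refine ⟨(1 - 2 * 2 ^ (-θ)) / 16, by linarith, by linarith, ?_⟩
    set z : ℝ := 2 * 2 ^ (-θ) with hz'
    have hz0 : 0 < z := by positivity
    nlinarith [mul_pos hz0 (sub_pos.2 hlt), mul_pos (mul_pos hz0 (sub_pos.2 hlt)) (sub_pos.2 hlt)]
  set L : ℝ := 2 * 2 ^ (-θ) * (1 + 2 * η) ^ 2 with hL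
  set K := 3 * C / (1 - L) with hK
  have hK0 : 0 ≤ K := div_nonneg (by linarith) (by linarith)
  have hKeq : K * L + 3 * C = K := by
    have h2 : 1 - L ≠ 0 := by linarith
    rw [hK]; field_simp; ring
  obtain ⟨c₁, hc₁, hnear⟩ := hJ.near_one η hη0
  -- Mass at most `c` gives both ‖J‖ ≤ 1 + η and an induction error K w^θ ≤ η, hence products of
  -- norm at most 1 + 2η.
  set c := min c₁ ((η / (K + 1)) ^ (1 / θ)) with hc
  have hcpos : 0 < c := lt_min hc₁ (by positivity)
  have hKc : ∀ x, 0 ≤ x → x ≤ c → K * x ^ θ ≤ η := by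
    intro x hx hxc
    have : x ^ θ ≤ η / (K + 1) := by
      calc x ^ θ ≤ ((η / (K + 1)) ^ (1 / θ)) ^ θ :=
            Real.rpow_le_rpow hx (hxc.trans (min_le_right _ _)) (by linarith)
        _ = _ := by
            rw [← Real.rpow_mul (by positivity), one_div, inv_mul_cancel₀ (by linarith),
              Real.rpow_one]
    calc K * x ^ θ ≤ K * (η / (K + 1)) := by gcongr
      _ = η * (K / (K + 1)) := by ring
      _ ≤ η * 1 := by gcongr; exact (div_le_one (by linarith)).2 (by linarith)
      _ = η := mul_one _
  refine ⟨c, hcpos, K, hK0, fun t ht hm m => ?_⟩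
  induction m using Nat.strong_induction_on with
  | _ m ih =>
  intro i hcw
  rcases eq_or_ne m 0 with rfl | hm0
  · simp only [seqProd, add_zero, hJ.self _ (hm i), sub_self, norm_zero]
    exact mul_nonneg hK0 (Real.rpow_nonneg (hw.nonneg _ _) _)
  obtain ⟨k, l, hkl, hwL, hwR⟩ := hw.exists_split_half ht hm i hm0
  have hwn := hw.nonneg (t i) (t (i + m))
  have him : i + m = i + (k + 1) + l := by omega
  set W := w (t i) (t (i + m)) with hW
  have t1 : t i ≤ t (i + k) := ht (by omega)
  have t2 : t (i + k) ≤ t (i + (k + 1)) := ht (by omega)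
  have t3 : t (i + (k + 1)) ≤ t (i + m) := ht (by omega)
  have bL := (ih k (by omega) i (by linarith)).trans (mul_le_mul_of_nonneg_left
    (Real.rpow_le_rpow (hw.nonneg _ _) hwL (by linarith)) hK0)
  have bR := (ih l (by omega) (i + (k + 1)) (by linarith)).trans (mul_le_mul_of_nonneg_left
    (Real.rpow_le_rpow (hw.nonneg _ _) hwR (by linarith)) hK0)
  have hWη : K * (W / 2) ^ θ ≤ η := hKc _ (by linarith) (by linarith)
  have wM : w (t (i + k)) (t (i + (k + 1))) ≤ W := hw.mono (hm i).1 t1 t2 t3 (hm _).2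
  have wLM : w (t i) (t (i + (k + 1))) ≤ W := hw.mono (hm i).1 le_rfl (t1.trans t2) t3 (hm _).2
  have nL : ‖J (t i) (t (i + k))‖ ≤ 1 + η :=
    hnear _ _ (hm _).1 t1 (hm _).2 (by linarith [min_le_left c₁ ((η / (K + 1)) ^ (1 / θ))])
  have nM : ‖J (t (i + k)) (t (i + (k + 1)))‖ ≤ 1 + η :=
    hnear _ _ (hm _).1 t2 (hm _).2 (by linarith [min_le_left c₁ ((η / (K + 1)) ^ (1 / θ))])
  have nR : ‖J (t (i + (k + 1))) (t (i + m))‖ ≤ 1 + η :=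
    hnear _ _ (hm _).1 t3 (hm _).2
      (by rw [← him] at hwR; linarith [min_le_left c₁ ((η / (K + 1)) ^ (1 / θ))])
  have e1 : ‖J (t (i + k)) (t (i + (k + 1))) * J (t i) (t (i + k)) - J (t i) (t (i + (k + 1)))‖
      ≤ C * W ^ θ := (hC _ _ _ (hm i).1 t1 t2 (hm _).2).trans (mul_le_mul_of_nonneg_left
        (Real.rpow_le_rpow (hw.nonneg _ _) wLM (by linarith)) hC0)
  have e2 := hC _ _ _ (hm i).1 (t1.trans t2) t3 (hm (i + m)).2
  rw [← him] at bR
  have hprod : seqProd J t i m = seqProd J t (i + (k + 1)) l *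
      (J (t (i + k)) (t (i + (k + 1))) * seqProd J t i k) := by rw [hkl, seqProd_split]
  rw [hprod]
  have nPL : ‖seqProd J t i k‖ ≤ 1 + 2 * η := by
    have := norm_le_norm_add_norm_sub' (seqProd J t i k) (J (t i) (t (i + k)))
    linarith
  generalize seqProd J t (i + (k + 1)) l = PR at *
  generalize seqProd J t i k = PL at *
  generalize J (t (i + (k + 1))) (t (i + m)) = JR at *
  generalize J (t (i + k)) (t (i + (k + 1))) = JM at *
  generalize J (t i) (t (i + k)) = JL at *
  generalize J (t i) (t (i + (k + 1))) = JLM at *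
  generalize J (t i) (t (i + m)) = J0 at *
  -- The first two terms are induction errors of the two parts. The last two are defects, bounded by
  -- 2C W^θ (as ‖JR‖ ≤ 1 + η ≤ 2) and C W^θ; this is the 3C in the equation for `K`.
  have hdec : PR * (JM * PL) - J0 = (PR - JR) * JM * PL + JR * JM * (PL - JL) +
      JR * (JM * JL - JLM) + (JR * JLM - J0) := by noncomm_ring
  rw [hdec]
  refine norm_add₄_le.trans ?_
  have n1 : ‖(PR - JR) * JM * PL‖ ≤ K * (W / 2) ^ θ * (1 + 2 * η) * (1 + 2 * η) :=
    norm_mul₃_le.trans (by gcongr; linarith)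
  have n2 : ‖JR * JM * (PL - JL)‖ ≤ (1 + 2 * η) * (1 + 2 * η) * (K * (W / 2) ^ θ) :=
    norm_mul₃_le.trans (by gcongr <;> linarith)
  have n3 : ‖JR * (JM * JL - JLM)‖ ≤ 2 * (C * W ^ θ) :=
    (norm_mul_le _ _).trans (by gcongr; linarith)
  rw [half_rpow hwn] at n1 n2
  calc _ ≤ K * (2 ^ (-θ) * W ^ θ) * (1 + 2 * η) * (1 + 2 * η) +
        (1 + 2 * η) * (1 + 2 * η) * (K * (2 ^ (-θ) * W ^ θ)) + 2 * (C * W ^ θ) + C * W ^ θ := by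
        gcongr
    _ = (K * L + 3 * C) * W ^ θ := by rw [hL]; ring
    _ = K * W ^ θ := by rw [hKeq]

/-- Pieces of mass at most `c` are peeled off one at a time. Each peeling lowers the remaining mass
by `c` and costs a factor `B'` for the piece and another for the separating interval, whose own mass
need not be small. Total mass at most (N + 1)c thus gives N + 1 pieces and N separators, at most 2N
+ 1 factors. -/
theorem exists_bound (hJ : IsAlmostMultiplicative T θ w J) (hw : IsSuperadditive T w)
    (hθ : 1 < θ) :
    ∃ M ≥ 0, ∀ t : ℕ → ℝ, Monotone t → (∀ k, t k ∈ Icc 0 T) → ∀ i m : ℕ,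
      ‖seqProd J t i m‖ ≤ M := by
  obtain ⟨c, hc, K, hK0, hloc⟩ := hJ.exists_local_bound hw hθ
  obtain ⟨B, hB⟩ := hJ.bounded
  set B' := max 1 (B + K * c ^ θ) with hB'
  have hB1 : 1 ≤ B' := le_max_left _ _
  have hKc : 0 ≤ K * c ^ θ := by positivity
  have hBB : B ≤ B' := le_trans (by linarith) (le_max_right _ _)
  have hsmall : ∀ t : ℕ → ℝ, Monotone t → (∀ k, t k ∈ Icc 0 T) → ∀ i m : ℕ,
      w (t i) (t (i + m)) ≤ c → ‖seqProd J t i m‖ ≤ B' := by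
    intro t ht hm i m hcw
    have h1 := hloc t ht hm m i hcw
    have h2 := norm_le_norm_add_norm_sub' (seqProd J t i m) (J (t i) (t (i + m)))
    have h3 := hB _ _ (hm i).1 (ht (Nat.le_add_right i m)) (hm (i + m)).2
    have h4 : K * w (t i) (t (i + m)) ^ θ ≤ K * c ^ θ := by
      have := hw.nonneg (t i) (t (i + m))
      gcongr
    exact le_trans (by linarith) (le_max_right _ _)
  have hind : ∀ N : ℕ, ∀ t : ℕ → ℝ, Monotone t → (∀ k, t k ∈ Icc 0 T) → ∀ i m : ℕ,
      w (t i) (t (i + m)) ≤ (N + 1) * c → ‖seqProd J t i m‖ ≤ B' ^ (2 * N + 1) := by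
    intro N
    induction N with
    | zero =>
      intro t ht hm i m hcw
      simpa using hsmall t ht hm i m (by simpa using hcw)
    | succ N ih =>
      intro t ht hm i m hcw
      rcases hw.exists_split ht hm i m c hc.le with h | ⟨k, l, hkl, hL, hR⟩
      · exact (hsmall t ht hm i m h).trans (le_self_pow₀ hB1 (by omega))
      · have bR := ih t ht hm (i + (k + 1)) l (by push_cast at hcw; linarith)
        have bL := hsmall t ht hm i k hL
        have bM := (hB _ _ (hm (i + k)).1 (ht (by omega : i + k ≤ i + (k + 1))) (hm _).2).trans hBB
        rw [hkl, seqProd_split, ← mul_assoc]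
        refine norm_mul₃_le.trans ?_
        calc _ ≤ B' ^ (2 * N + 1) * B' * B' := by gcongr
          _ = B' ^ (2 * (N + 1) + 1) := by ring
  obtain ⟨N, hN⟩ := exists_nat_ge (w 0 T / c)
  refine ⟨B' ^ (2 * N + 1), by positivity, fun t ht hm i m => hind N t ht hm i m ?_⟩
  have h1 : w (t i) (t (i + m)) ≤ w 0 T :=
    hw.mono le_rfl (hm i).1 (ht (Nat.le_add_right i m)) (hm _).2 le_rfl
  rw [div_le_iff₀ hc] at hN
  nlinarith

/-- Where the mass exceeds `c`, the product and the single factor are both bounded while w^θ ≥ c^θ,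
so enlarging the local constant is enough. -/
theorem exists_global_bound (hJ : IsAlmostMultiplicative T θ w J) (hw : IsSuperadditive T w)
    (hθ : 1 < θ) :
    ∃ K ≥ 0, ∀ t : ℕ → ℝ, Monotone t → (∀ k, t k ∈ Icc 0 T) → ∀ m i : ℕ,
      ‖seqProd J t i m - J (t i) (t (i + m))‖ ≤ K * w (t i) (t (i + m)) ^ θ := by
  obtain ⟨c, hc, K, hK0, hloc⟩ := hJ.exists_local_bound hw hθ
  obtain ⟨M, hM0, hM⟩ := hJ.exists_bound hw hθ
  obtain ⟨B, hB⟩ := hJ.bounded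
  refine ⟨max K ((M + |B|) / c ^ θ), le_max_of_le_left hK0, fun t ht hm m i => ?_⟩
  have hn := hw.nonneg (t i) (t (i + m))
  by_cases h : w (t i) (t (i + m)) ≤ c
  · refine (hloc t ht hm m i h).trans ?_
    gcongr
    exact le_max_left _ _
  · have h1 := hB _ _ (hm i).1 (ht (Nat.le_add_right i m)) (hm (i + m)).2
    calc _ ≤ ‖seqProd J t i m‖ + ‖J (t i) (t (i + m))‖ := norm_sub_le _ _
      _ ≤ M + |B| := add_le_add (hM t ht hm i m) (h1.trans (le_abs_self B))
      _ = (M + |B|) / c ^ θ * c ^ θ := by field_simp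
      _ ≤ max K ((M + |B|) / c ^ θ) * w (t i) (t (i + m)) ^ θ := by
        gcongr
        · exact le_max_right _ _
        · exact (not_le.1 h).le

end IsAlmostMultiplicative

/-! ### Davie-type solutions of an almost multiplicative evolution -/

section Evolution

variable {E : Type*} [NormedAddCommGroup E] [NormedSpace ℝ E] {T θ : ℝ} {w : ℝ → ℝ → ℝ}
  {J : ℝ → ℝ → E →L[ℝ] E}

theorem exists_fine_sequence {s t : ℝ} (hst : s ≤ t) {δ : ℝ} (hδ : 0 < δ) :
    ∃ (τ : ℕ → ℝ) (N : ℕ), Monotone τ ∧ τ 0 = s ∧ τ N = t ∧ (∀ k, τ k ∈ Icc s t) ∧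
      ∀ i < N, τ (i + 1) - τ i < δ := by
  obtain ⟨N, hN⟩ := exists_nat_gt ((t - s) / δ)
  have hN0 : 0 ≤ (t - s) / δ := div_nonneg (by linarith) hδ.le
  have hNpos : (0 : ℝ) < N := hN0.trans_lt hN
  -- A uniform grid; `min k N` keeps the sequence at the right end point after index `N`, so that it
  -- is monotone on all of ℕ.
  have hmono : Monotone fun k : ℕ => s + (t - s) * ((min k N : ℕ) / N : ℝ) := by
    intro a b hab
    have : ((min a N : ℕ) : ℝ) ≤ (min b N : ℕ) := by
      exact_mod_cast min_le_min_right N hab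
    have h0 : 0 ≤ t - s := by linarith
    dsimp only
    gcongr
  refine ⟨fun k => s + (t - s) * ((min k N : ℕ) / N : ℝ), N, hmono, by simp, ?_, fun k => ?_, ?_⟩
  · simp only [min_self]
    rw [div_self hNpos.ne']; ring
  · refine ⟨?_, ?_⟩
    · have h0 : 0 ≤ t - s := by linarith
      have : 0 ≤ (t - s) * ((min k N : ℕ) / N : ℝ) := by positivity
      linarith
    · have h1 : ((min k N : ℕ) / N : ℝ) ≤ 1 := by
        rw [div_le_one hNpos]; exact_mod_cast min_le_right k N
      nlinarith
  · intro i hi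
    have h1 : min (i + 1) N = i + 1 := min_eq_left hi
    have h2 : min i N = i := min_eq_left hi.le
    simp only [h1, h2]
    rw [div_lt_iff₀ hδ] at hN
    push_cast
    have : s + (t - s) * ((i + 1) / N : ℝ) - (s + (t - s) * (i / N)) = (t - s) / N := by
      field_simp; ring
    rw [this, div_lt_iff₀ hNpos]
    linarith

theorem exists_sequence_of_finset (hT : 0 ≤ T) (F : Finset ℝ) (hF : ∀ x ∈ F, x ∈ Icc 0 T) :
    ∃ τ : ℕ → ℝ, Monotone τ ∧ τ 0 = 0 ∧ (∀ k, τ k ∈ Icc 0 T) ∧ ∀ x ∈ F, ∃ k, τ k = x := by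
  -- The induction appends the maximum `a` after index `N`. The clause on upper bounds is what
  -- ensures that all earlier terms, including those past the last used index, stay below `a`.
  suffices h : ∃ (τ : ℕ → ℝ) (N : ℕ), Monotone τ ∧ τ 0 = 0 ∧
      (∀ b, 0 ≤ b → (∀ x ∈ F, x ≤ b) → ∀ k, τ k ≤ b) ∧ ∀ x ∈ F, ∃ k ≤ N, τ k = x by
    obtain ⟨τ, N, h1, h2, h3, h4⟩ := h
    refine ⟨τ, h1, h2, fun k => ⟨h2 ▸ h1 (Nat.zero_le k), h3 T hT (fun x hx => (hF x hx).2) k⟩,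
      fun x hx => ?_⟩
    obtain ⟨k, -, hk⟩ := h4 x hx
    exact ⟨k, hk⟩
  induction F using Finset.induction_on_max with
  | empty => exact ⟨fun _ => 0, 0, monotone_const, rfl, fun b hb _ _ => hb, by simp⟩
  | insert a F ha ih =>
    obtain ⟨τ, N, h1, h2, h3, h4⟩ := ih fun x hx => hF x (Finset.mem_insert_of_mem hx)
    have ha0 := hF a (Finset.mem_insert_self a F)
    have hle := h3 a ha0.1 (fun x hx => (ha x hx).le)
    refine ⟨fun k => if k ≤ N then τ k else a, N + 1, ?_, by simp [h2], ?_, ?_⟩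
    · intro i j hij
      dsimp only
      split_ifs with hi hj hj
      · exact h1 hij
      · exact hle i
      · omega
      · exact le_rfl
    · intro b hb hx k
      dsimp only
      split_ifs
      · exact h3 b hb (fun x hxF => hx x (Finset.mem_insert_of_mem hxF)) k
      · exact hx a (Finset.mem_insert_self a F)
    · intro x hx
      rcases Finset.mem_insert.1 hx with rfl | hx
      · exact ⟨N + 1, le_rfl, by simp⟩
      · obtain ⟨k, hk, hkx⟩ := h4 x hx
        exact ⟨k, hk.trans (Nat.le_succ N), by simp [hk, hkx]⟩

/-- A discrete variation of constants: the one-step error at each time is transported to the end by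
the product of the remaining factors, of norm at most `M`, and these contributions add up. -/
theorem norm_sub_seqProd_le {M : ℝ} (D : ℝ → E) (t : ℕ → ℝ)
    (hM : ∀ i m, ‖seqProd J t i m‖ ≤ M) (m : ℕ) : ∀ i : ℕ,
    ‖D (t (i + m)) - seqProd J t i m (D (t i))‖ ≤
      M * ∑ k ∈ Finset.range m,
        ‖D (t (i + k + 1)) - J (t (i + k)) (t (i + k + 1)) (D (t (i + k)))‖ := by
  induction m with
  | zero => intro i; simp [seqProd]
  | succ m ih =>
    intro i
    have h1 : seqProd J t i (m + 1) = seqProd J t (i + 1) m * J (t i) (t (i + 1)) := by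
      rw [add_comm m 1, seqProd_add]; simp [seqProd]
    have h2 : i + (m + 1) = i + 1 + m := by omega
    have h3 : D (t (i + (m + 1))) - seqProd J t i (m + 1) (D (t i)) =
        (D (t (i + 1 + m)) - seqProd J t (i + 1) m (D (t (i + 1)))) +
        seqProd J t (i + 1) m (D (t (i + 1)) - J (t i) (t (i + 1)) (D (t i))) := by
      rw [h1, h2, map_sub, mul_apply_eq_comp]; abel
    rw [h3, Finset.sum_range_succ', mul_add]
    refine (norm_add_le _ _).trans (add_le_add ?_ ?_)
    · refine (ih (i + 1)).trans (le_of_eq ?_)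
      congr 1
      refine Finset.sum_congr rfl fun k _ => ?_
      rw [show i + 1 + k = i + (k + 1) by omega]
    · refine (ContinuousLinearMap.le_opNorm _ _).trans ?_
      simp only [add_zero]
      exact mul_le_mul_of_nonneg_right (hM _ _) (norm_nonneg _)

/-- Uniqueness: a path starting at zero which follows an almost multiplicative evolution up to
errors `w ^ θ`, `θ > 1`, vanishes. -/
theorem IsAlmostMultiplicative.eq_zero_of_norm_sub_le (hJ : IsAlmostMultiplicative T θ w J)
    (hw : IsControl T w) (hθ : 1 < θ) {D : ℝ → E} {C : ℝ} (hD0 : D 0 = 0)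
    (hD : ∀ s t, 0 ≤ s → s ≤ t → t ≤ T → ‖D t - J s t (D s)‖ ≤ C * w s t ^ θ) :
    ∀ t ∈ Icc 0 T, D t = 0 := by
  intro t ht
  obtain ⟨M, hM0, hM⟩ := hJ.exists_bound hw.toIsSuperadditive hθ
  rw [← norm_le_zero_iff]
  refine le_of_forall_pos_le_add fun ε hε => ?_
  obtain ⟨δ, hδ, h⟩ := hw.sum_rpow_small hθ (M * C) hε
  obtain ⟨τ, N, h1, h2, h3, h4, h5⟩ := exists_fine_sequence ht.1 hδ
  have hm : ∀ k, τ k ∈ Icc 0 T := fun k => ⟨(h4 k).1, (h4 k).2.trans ht.2⟩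
  have h6 := norm_sub_seqProd_le D τ (fun i m => hM τ h1 hm i m) N 0
  simp only [zero_add, h2, h3, hD0, map_zero, sub_zero] at h6
  have h7 := h τ N h1 hm h5
  have h8 : M * ∑ k ∈ Finset.range N, ‖D (τ (k + 1)) - J (τ k) (τ (k + 1)) (D (τ k))‖ ≤
      ∑ i ∈ Finset.range N, M * C * w (τ i) (τ (i + 1)) ^ θ := by
    rw [Finset.mul_sum]
    refine Finset.sum_le_sum fun k _ => ?_
    rw [mul_assoc]
    exact mul_le_mul_of_nonneg_left (hD _ _ (hm k).1 (h1 (Nat.le_succ k)) (hm _).2) hM0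
  linarith

/-- The path is the product of one-step maps up to the given time, applied to `v`; the global sewing
bound compares the product between two of its times with the single factor. `M` and `C` are chosen
before the finite set, as the compactness argument requires. -/
theorem IsAlmostMultiplicative.exists_finite_path (hJ : IsAlmostMultiplicative T θ w J)
    (hw : IsSuperadditive T w) (hT : 0 ≤ T) (hθ : 1 < θ) (v : E) :
    ∃ M C : ℝ, ∀ F : Finset ℝ, ∃ Y : ℝ → E, (∀ x, ‖Y x‖ ≤ M) ∧
      ∀ s t, s ∈ F → t ∈ F → 0 ∈ F → 0 ≤ s → s ≤ t → t ≤ T →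
        Y 0 = v ∧ ‖Y t - J s t (Y s)‖ ≤ C * w s t ^ θ := by
  obtain ⟨M, hM0, hM⟩ := hJ.exists_bound hw hθ
  obtain ⟨K, hK0, hK⟩ := hJ.exists_global_bound hw hθ
  refine ⟨M * ‖v‖, K * (M * ‖v‖), fun F => ?_⟩
  obtain ⟨τ, h1, h2, h3, h4⟩ := exists_sequence_of_finset hT (F.filter (· ∈ Icc 0 T))
    (fun x hx => (Finset.mem_filter.1 hx).2)
  -- Times outside the finite set receive the default index 0, so the path is defined and bounded
  -- everywhere.
  have h5 : ∀ x : ℝ, ∃ k, x ∈ F → x ∈ Icc 0 T → τ k = x := by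
    intro x
    by_cases hx : x ∈ F ∧ x ∈ Icc 0 T
    · obtain ⟨k, hk⟩ := h4 x (Finset.mem_filter.2 hx)
      exact ⟨k, fun _ _ => hk⟩
    · exact ⟨0, fun a b => absurd ⟨a, b⟩ hx⟩
  choose κ hκ using h5
  have hb : ∀ k, ‖seqProd J τ 0 k v‖ ≤ M * ‖v‖ := fun k =>
    (ContinuousLinearMap.le_opNorm _ _).trans
      (mul_le_mul_of_nonneg_right (hM τ h1 h3 0 k) (norm_nonneg v))
  have hstep : ∀ i m, ‖seqProd J τ 0 (i + m) v - J (τ i) (τ (i + m)) (seqProd J τ 0 i v)‖ ≤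
      K * (M * ‖v‖) * w (τ i) (τ (i + m)) ^ θ := by
    intro i m
    rw [seqProd_add, zero_add, mul_apply_eq_comp, ← sub_apply]
    refine (ContinuousLinearMap.le_opNorm _ _).trans ?_
    calc _ ≤ K * w (τ i) (τ (i + m)) ^ θ * (M * ‖v‖) :=
          mul_le_mul (hK τ h1 h3 m i) (hb i) (norm_nonneg _)
            (mul_nonneg hK0 (Real.rpow_nonneg (hw.nonneg _ _) _))
      _ = _ := by ring
  refine ⟨fun x => seqProd J τ 0 (κ x) v, fun x => hb _, fun s t hs ht h0 hs0 hst htT => ⟨?_, ?_⟩⟩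
  -- The index chosen for time 0 need not be 0, since the sequence may repeat that time. The sewing
  -- bound with w(0,0)^θ = 0 shows that the product up to it still fixes `v`.
  · have hk := hκ 0 h0 ⟨le_rfl, hT⟩
    have := hstep 0 (κ 0)
    rw [zero_add, hk, h2, hw.self le_rfl hT, Real.zero_rpow (by linarith), mul_zero,
      norm_le_zero_iff, hJ.self 0 ⟨le_rfl, hT⟩] at this
    simpa [seqProd, sub_eq_zero] using this
  · have hks := hκ s hs ⟨hs0, hst.trans htT⟩
    have hkt := hκ t ht ⟨hs0.trans hst, htT⟩
    rcases hst.eq_or_lt with rfl | hlt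
    · simp only [hJ.self s ⟨hs0, htT⟩, one_apply_eq_self, sub_self, norm_zero]
      have := (norm_nonneg _).trans (hstep (κ s) 0)
      rwa [add_zero, hks] at this
    · have hle : κ s ≤ κ t := by
        by_contra hcon
        have := h1 (not_le.1 hcon).le
        rw [hks, hkt] at this
        linarith
      obtain ⟨m, hm⟩ := Nat.exists_eq_add_of_le hle
      have := hstep (κ s) m
      rwa [← hm, hks, hkt] at this

/-- Existence of a path following an almost multiplicative evolution, by compactness from its
values on finite sets of times. -/
theorem IsAlmostMultiplicative.exists_path [ProperSpace E] (hJ : IsAlmostMultiplicative T θ w J)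
    (hw : IsSuperadditive T w) (hT : 0 ≤ T) (hθ : 1 < θ) (v : E) :
    ∃ (V : ℝ → E) (M C : ℝ), V 0 = v ∧ (∀ t, ‖V t‖ ≤ M) ∧
      ∀ s t, 0 ≤ s → s ≤ t → t ≤ T → ‖V t - J s t (V s)‖ ≤ C * w s t ^ θ := by
  obtain ⟨M, C, h⟩ := hJ.exists_finite_path hw hT hθ v
  choose Y hYb hY using h
  -- Along an ultrafilter finer than `atTop` every time eventually belongs to the finite set, and
  -- the bounded values at each time converge. The estimates are closed conditions on two values, so
  -- they survive without any equicontinuity.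
  let U : Ultrafilter (Finset ℝ) := Ultrafilter.of Filter.atTop
  have hU : (U : Filter (Finset ℝ)) ≤ Filter.atTop := Ultrafilter.of_le _
  have hlim : ∀ x : ℝ, ∃ a ∈ Metric.closedBall (0 : E) M,
      Filter.Tendsto (fun F => Y F x) U (nhds a) := fun x =>
    (isCompact_closedBall (0 : E) M).ultrafilter_le_nhds (U.map fun F => Y F x)
      (Filter.tendsto_principal.2 (Filter.Eventually.of_forall fun G => by
        simpa using hYb G x))
  choose V hVb hV using hlim
  have hmem : ∀ x : ℝ, ∀ᶠ F in (U : Filter (Finset ℝ)), x ∈ F := fun x =>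
    hU ((Filter.eventually_ge_atTop {x}).mono fun F hF => hF (Finset.mem_singleton_self x))
  refine ⟨V, M, C, ?_, fun t => by simpa using hVb t, fun s t hs hst ht => ?_⟩
  · refine tendsto_nhds_unique (hV 0) (tendsto_const_nhds.congr' ?_)
    filter_upwards [hmem 0] with F hF
    exact (hY F 0 0 hF hF hF le_rfl le_rfl hT).1.symm
  · refine le_of_tendsto (((hV t).sub (((J s t).continuous.tendsto _).comp (hV s))).norm) ?_
    filter_upwards [hmem 0, hmem s, hmem t] with F h0 hs' ht'
    exact (hY F s t hs' ht' h0 hs hst ht).2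

end Evolution

/-! ### Variation over partitions -/

namespace IntervalPartition

variable {a b c : ℝ}

/-- The points of a partition, continued by the right end point. -/
def clamp (π : IntervalPartition a b) (k : ℕ) : ℝ := π.pt (min k π.n)

theorem monotone_clamp (π : IntervalPartition a b) : Monotone π.clamp := by
  refine monotone_nat_of_le_succ fun k => ?_
  unfold clamp
  rcases lt_or_ge k π.n with h | h
  · rw [min_eq_left h.le, min_eq_left (Nat.succ_le_of_lt h)]
    exact π.mono k h
  · rw [min_eq_right h, min_eq_right (h.trans (Nat.le_succ k))]

theorem clamp_of_le (π : IntervalPartition a b) {k : ℕ} (h : k ≤ π.n) : π.clamp k = π.pt k := by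
  rw [clamp, min_eq_left h]

theorem clamp_zero (π : IntervalPartition a b) : π.clamp 0 = a := by
  rw [π.clamp_of_le (Nat.zero_le _), π.first]

theorem clamp_n (π : IntervalPartition a b) : π.clamp π.n = b := by
  rw [π.clamp_of_le le_rfl, π.last]

theorem clamp_mem (π : IntervalPartition a b) (k : ℕ) : π.clamp k ∈ Icc a b := by
  have h1 := π.monotone_clamp (Nat.zero_le k)
  have h2 := π.monotone_clamp (min_le_right k π.n)
  rw [π.clamp_zero] at h1
  rw [π.clamp_n, π.clamp_of_le (min_le_right k π.n)] at h2
  exact ⟨h1, h2⟩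

theorem le (π : IntervalPartition a b) : a ≤ b := (π.clamp_mem 0).1.trans (π.clamp_mem 0).2

theorem sum_clamp {M : Type*} [AddCommMonoid M] (π : IntervalPartition a b) (f : ℝ → ℝ → M) :
    ∑ i ∈ Finset.range π.n, f (π.pt i) (π.pt (i + 1)) =
      ∑ i ∈ Finset.range π.n, f (π.clamp i) (π.clamp (i + 1)) := by
  refine Finset.sum_congr rfl fun i hi => ?_
  have hi := Finset.mem_range.1 hi
  rw [π.clamp_of_le hi.le, π.clamp_of_le (Nat.succ_le_of_lt hi)]

/-- The partition into a single interval. -/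
def single (h : a ≤ b) : IntervalPartition a b :=
  ⟨1, fun k => if k = 0 then a else b, rfl, rfl, fun i hi => by
    have : i = 0 := by omega
    simp [this, h]⟩

/-- Concatenation of partitions. -/
def trans (π : IntervalPartition a b) (ρ : IntervalPartition b c) : IntervalPartition a c where
  n := π.n + ρ.n
  pt k := if k ≤ π.n then π.pt k else ρ.pt (k - π.n)
  first := by simp [π.first]
  last := by
    split_ifs with h
    · have h0 : ρ.n = 0 := by omega
      have := ρ.last
      rw [h0] at this ⊢
      rw [add_zero, π.last, ← this, ρ.first]
    · rw [Nat.add_sub_cancel_left, ρ.last]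
  mono i hi := by
    split_ifs with h1 h2 h2
    · exact π.mono i h2
    · have : i = π.n := by omega
      rw [this, π.last, Nat.add_sub_cancel_left]
      exact ρ.first.symm.le.trans (ρ.mono 0 (by omega))
    · omega
    · rw [Nat.sub_add_comm (by omega)]
      exact ρ.mono _ (by omega)

theorem trans_pt_left (π : IntervalPartition a b) (ρ : IntervalPartition b c) {k : ℕ}
    (hk : k ≤ π.n) : (π.trans ρ).pt k = π.pt k := if_pos hk

theorem trans_pt_right (π : IntervalPartition a b) (ρ : IntervalPartition b c) (k : ℕ) :
    (π.trans ρ).pt (π.n + k) = ρ.pt k := by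
  unfold trans
  dsimp only
  split_ifs with h
  · have h0 : k = 0 := by omega
    rw [h0, add_zero, π.last, ρ.first]
  · rw [Nat.add_sub_cancel_left]

theorem sum_trans {M : Type*} [AddCommMonoid M] (π : IntervalPartition a b)
    (ρ : IntervalPartition b c) (f : ℝ → ℝ → M) :
    ∑ i ∈ Finset.range (π.trans ρ).n, f ((π.trans ρ).pt i) ((π.trans ρ).pt (i + 1)) =
      (∑ i ∈ Finset.range π.n, f (π.pt i) (π.pt (i + 1))) +
        ∑ i ∈ Finset.range ρ.n, f (ρ.pt i) (ρ.pt (i + 1)) := by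
  have hn : (π.trans ρ).n = π.n + ρ.n := rfl
  rw [hn, Finset.sum_range_add]
  congr 1
  · refine Finset.sum_congr rfl fun i hi => ?_
    have hi := Finset.mem_range.1 hi
    rw [trans_pt_left _ _ hi.le, trans_pt_left _ _ (Nat.succ_le_of_lt hi)]
  · refine Finset.sum_congr rfl fun i _ => ?_
    rw [add_assoc, trans_pt_right, trans_pt_right]

theorem trans_mesh (π : IntervalPartition a b) (ρ : IntervalPartition b c) {δ : ℝ}
    (hπ : ∀ i < π.n, π.pt (i + 1) - π.pt i < δ) (hρ : ∀ i < ρ.n, ρ.pt (i + 1) - ρ.pt i < δ) :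
    ∀ i < (π.trans ρ).n, (π.trans ρ).pt (i + 1) - (π.trans ρ).pt i < δ := by
  intro i hi
  have hn : (π.trans ρ).n = π.n + ρ.n := rfl
  rcases lt_or_ge i π.n with h | h
  · rw [trans_pt_left _ _ h.le, trans_pt_left _ _ (Nat.succ_le_of_lt h)]
    exact hπ i h
  · obtain ⟨k, rfl⟩ := Nat.exists_eq_add_of_le h
    rw [add_assoc, trans_pt_right, trans_pt_right]
    exact hρ k (by omega)

end IntervalPartition

section Variation

variable {F : Type*} [NormedAddCommGroup F] {T α β : ℝ} {R : ℝ → ℝ → F}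

/-- The supremum over partitions of `[s, t]` of the sums of `α`-th powers of increments. -/
noncomputable def powerVariation (α : ℝ) (R : ℝ → ℝ → F) (s t : ℝ) : ℝ≥0∞ :=
  ⨆ π : IntervalPartition s t, ∑ i ∈ Finset.range π.n, ‖R (π.pt i) (π.pt (i + 1))‖ₑ ^ α

theorem pVariation_lt_top_iff (hα : 0 < α) (R : ℝ → ℝ → F) (s t : ℝ) :
    pVariation α R s t < ∞ ↔ powerVariation α R s t < ∞ :=
  ENNReal.rpow_lt_top_iff_of_pos (one_div_pos.2 hα)

theorem powerVariation_add_le {s r t : ℝ} (h1 : s ≤ r) (h2 : r ≤ t) :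
    powerVariation α R s r + powerVariation α R r t ≤ powerVariation α R s t := by
  have : Nonempty (IntervalPartition s r) := ⟨.single h1⟩
  have : Nonempty (IntervalPartition r t) := ⟨.single h2⟩
  refine ENNReal.iSup_add_iSup_le fun π ρ => ?_
  rw [← π.sum_trans ρ fun x y => ‖R x y‖ₑ ^ α]
  exact le_iSup (fun π : IntervalPartition s t =>
    ∑ i ∈ Finset.range π.n, ‖R (π.pt i) (π.pt (i + 1))‖ₑ ^ α) (π.trans ρ)

theorem powerVariation_mono {s s' t' t : ℝ} (h1 : s ≤ s') (h2 : s' ≤ t') (h3 : t' ≤ t) :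
    powerVariation α R s' t' ≤ powerVariation α R s t :=
  calc _ ≤ powerVariation α R s s' + powerVariation α R s' t' := le_add_self
    _ ≤ powerVariation α R s t' := powerVariation_add_le h1 h2
    _ ≤ powerVariation α R s t' + powerVariation α R t' t := le_self_add
    _ ≤ _ := powerVariation_add_le (h1.trans h2) h3

theorem enorm_rpow_le_powerVariation {s t : ℝ} (h : s ≤ t) :
    ‖R s t‖ₑ ^ α ≤ powerVariation α R s t := by
  refine le_trans (le_of_eq ?_) (le_iSup (fun π : IntervalPartition s t =>
    ∑ i ∈ Finset.range π.n, ‖R (π.pt i) (π.pt (i + 1))‖ₑ ^ α) (.single h))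
  simp [IntervalPartition.single]

theorem isSuperadditive_powerVariation (h : powerVariation α R 0 T < ∞) :
    IsSuperadditive T fun s t => (powerVariation α R s t).toReal where
  nonneg s t := ENNReal.toReal_nonneg
  add_le s r t h0 h1 h2 h3 := by
    have hf : powerVariation α R s t < ∞ := (powerVariation_mono h0 (h1.trans h2) h3).trans_lt h
    have hf1 := (powerVariation_mono (α := α) (R := R) le_rfl h1 h2).trans_lt hf
    have hf2 := (powerVariation_mono (α := α) (R := R) h1 h2 le_rfl).trans_lt hf
    rw [← ENNReal.toReal_add hf1.ne hf2.ne]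
    exact ENNReal.toReal_mono hf.ne (powerVariation_add_le h1 h2)

theorem norm_le_powerVariation (hα : 0 < α) (h : powerVariation α R 0 T < ∞) {s t : ℝ}
    (h0 : 0 ≤ s) (h1 : s ≤ t) (h2 : t ≤ T) :
    ‖R s t‖ ≤ (powerVariation α R s t).toReal ^ (1 / α) := by
  have hf : powerVariation α R s t < ∞ := (powerVariation_mono h0 h1 h2).trans_lt h
  have h3 := ENNReal.toReal_mono hf.ne (enorm_rpow_le_powerVariation (α := α) (R := R) h1)
  rw [← ENNReal.toReal_rpow, toReal_enorm] at h3
  calc ‖R s t‖ = (‖R s t‖ ^ α) ^ (1 / α) := by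
        rw [← Real.rpow_mul (norm_nonneg _), mul_one_div_cancel hα.ne', Real.rpow_one]
    _ ≤ _ := Real.rpow_le_rpow (Real.rpow_nonneg (norm_nonneg _) _) h3 (one_div_pos.2 hα).le

/-- Interpolation ‖R‖^β ≤ c^(β-α) ‖R‖^α, term by term. With `c` small near the diagonal, it makes
the β-variation a control. -/
theorem powerVariation_le_mul {s t : ℝ} (hα : 0 ≤ α) (hαβ : α ≤ β) {c : ℝ≥0∞}
    (hc : ∀ x y, s ≤ x → x ≤ y → y ≤ t → ‖R x y‖ₑ ≤ c) :
    powerVariation β R s t ≤ c ^ (β - α) * powerVariation α R s t := by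
  refine iSup_le fun π => ?_
  refine le_trans ?_ (mul_le_mul_right (le_iSup (fun π : IntervalPartition s t =>
    ∑ i ∈ Finset.range π.n, ‖R (π.pt i) (π.pt (i + 1))‖ₑ ^ α) π) _)
  rw [Finset.mul_sum]
  refine Finset.sum_le_sum fun i hi => ?_
  have hi := Finset.mem_range.1 hi
  have e : β = (β - α) + α := by ring
  nth_rewrite 1 [e]
  rw [ENNReal.rpow_add_of_nonneg _ _ (by linarith) hα]
  refine mul_le_mul_left (ENNReal.rpow_le_rpow ?_ (by linarith)) _
  rw [← π.clamp_of_le hi.le, ← π.clamp_of_le (Nat.succ_le_of_lt hi)]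
  exact hc _ _ (π.clamp_mem _).1 (π.monotone_clamp (Nat.le_succ i)) (π.clamp_mem _).2

/-- Keeps the exact exponent and gives up smallness near the diagonal, which is not needed to show
that a p-variation is finite. -/
theorem exists_isSuperadditive_of_pVariation (hα : 0 < α) (h : pVariation α R 0 T < ∞) :
    ∃ u, IsSuperadditive T u ∧ ∀ s t, 0 ≤ s → s ≤ t → t ≤ T → ‖R s t‖ ≤ u s t ^ (1 / α) := by
  rw [pVariation_lt_top_iff hα] at h
  exact ⟨_, isSuperadditive_powerVariation h, fun s t => norm_le_powerVariation hα h⟩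

/-- A function of two times of finite `α`-variation that is small near the diagonal is dominated by
a control in the sense of `β`-variation for every `β > α`. -/
theorem exists_isControl_of_pVariation (hα : 0 < α) (hαβ : α < β) (h : pVariation α R 0 T < ∞)
    (hsmall : ∀ ε > 0, ∃ δ > 0, ∀ s t, 0 ≤ s → s ≤ t → t ≤ T → t - s < δ → ‖R s t‖ ≤ ε) :
    ∃ w, IsControl T w ∧ ∀ s t, 0 ≤ s → s ≤ t → t ≤ T → ‖R s t‖ ≤ w s t ^ (1 / β) := by
  rw [pVariation_lt_top_iff hα] at h
  set P := (powerVariation α R 0 T).toReal with hP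
  have hP0 : 0 ≤ P := ENNReal.toReal_nonneg
  have hPeq : powerVariation α R 0 T = ENNReal.ofReal P := (ENNReal.ofReal_toReal h.ne).symm
  have hle : ∀ (c s t : ℝ), 0 ≤ c → 0 ≤ s → s ≤ t → t ≤ T →
      (∀ x y, s ≤ x → x ≤ y → y ≤ t → ‖R x y‖ ≤ c) →
      powerVariation β R s t ≤ ENNReal.ofReal (c ^ (β - α) * P) := by
    intro c s t hc h0 h1 h2 h3
    rw [ENNReal.ofReal_mul (Real.rpow_nonneg hc _), ← hPeq,
      ← ENNReal.ofReal_rpow_of_nonneg hc (by linarith)]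
    refine (powerVariation_le_mul hα.le hαβ.le (c := ENNReal.ofReal c) ?_).trans
      (mul_le_mul_right (powerVariation_mono h0 h1 h2) _)
    intro x y hx hxy hy
    rw [← ofReal_norm]
    exact ENNReal.ofReal_le_ofReal (h3 x y hx hxy hy)
  have hfin : powerVariation β R 0 T < ∞ := by
    rcases le_or_gt 0 T with hT | hT
    -- Each value of `R` is bounded by the total variation; for T < 0 there are no partitions and
    -- the supremum is zero.
    · refine (hle (P ^ (1 / α)) 0 T (Real.rpow_nonneg hP0 _) le_rfl hT le_rfl
        fun x y hx hxy hy => ?_).trans_lt ENNReal.ofReal_lt_top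
      refine (norm_le_powerVariation hα h hx hxy hy).trans
        (Real.rpow_le_rpow ENNReal.toReal_nonneg ?_ (one_div_pos.2 hα).le)
      exact ENNReal.toReal_mono h.ne (powerVariation_mono hx hxy hy)
    · have : IsEmpty (IntervalPartition 0 T) := ⟨fun π => absurd π.le (not_le.2 hT)⟩
      simp [powerVariation]
  refine ⟨_, ⟨isSuperadditive_powerVariation hfin, fun ε hε => ?_⟩,
    fun s t => norm_le_powerVariation (hα.trans hαβ) hfin⟩
  obtain ⟨δ, hδ, hd⟩ := hsmall ((ε / (2 * (P + 1))) ^ (1 / (β - α))) (by positivity)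
  refine ⟨δ, hδ, fun s t h0 h1 h2 h3 => ?_⟩
  have h4 := hle _ s t (by positivity) h0 h1 h2 fun x y hx hxy hy =>
    hd x y (h0.trans hx) hxy (hy.trans h2) (by linarith)
  rw [← Real.rpow_mul (by positivity), one_div_mul_cancel (by linarith), Real.rpow_one] at h4
  have h5 : ε / (2 * (P + 1)) * P < ε := by
    rw [div_mul_eq_mul_div, div_lt_iff₀ (by positivity)]; nlinarith
  exact (ENNReal.toReal_le_of_le_ofReal (by positivity) h4).trans_lt h5

theorem pVariation_lt_top_of_norm_le {u : ℝ → ℝ → ℝ} (hu : IsSuperadditive T u) (hα : 0 < α)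
    {C : ℝ} (h : ∀ s t, 0 ≤ s → s ≤ t → t ≤ T → ‖R s t‖ ≤ C * u s t ^ (1 / α)) :
    pVariation α R 0 T < ∞ := by
  rw [pVariation_lt_top_iff hα]
  refine lt_of_le_of_lt (b := ENNReal.ofReal (|C| ^ α * u 0 T)) (iSup_le fun π => ?_)
    ENNReal.ofReal_lt_top
  rw [π.sum_clamp fun x y => ‖R x y‖ₑ ^ α]
  have hterm : ∀ i ∈ Finset.range π.n, ‖R (π.clamp i) (π.clamp (i + 1))‖ₑ ^ α ≤
      ENNReal.ofReal (|C| ^ α * u (π.clamp i) (π.clamp (i + 1))) := by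
    intro i _
    have hn := hu.nonneg (π.clamp i) (π.clamp (i + 1))
    rw [← ofReal_norm, ENNReal.ofReal_rpow_of_nonneg (norm_nonneg _) hα.le]
    refine ENNReal.ofReal_le_ofReal ?_
    have h1 := h _ _ (π.clamp_mem i).1 (π.monotone_clamp (Nat.le_succ i)) (π.clamp_mem (i + 1)).2
    calc _ ≤ (|C| * u (π.clamp i) (π.clamp (i + 1)) ^ (1 / α)) ^ α := by
          refine Real.rpow_le_rpow (norm_nonneg _) (h1.trans ?_) hα.le
          gcongr
          exact le_abs_self C
      _ = _ := by
          rw [Real.mul_rpow (abs_nonneg _) (Real.rpow_nonneg hn _), ← Real.rpow_mul hn,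
            one_div_mul_cancel hα.ne', Real.rpow_one]
  refine (Finset.sum_le_sum hterm).trans ?_
  rw [← ENNReal.ofReal_sum_of_nonneg fun i _ =>
    mul_nonneg (Real.rpow_nonneg (abs_nonneg _) _) (hu.nonneg _ _), ← Finset.mul_sum]
  refine ENNReal.ofReal_le_ofReal (mul_le_mul_of_nonneg_left ?_
    (Real.rpow_nonneg (abs_nonneg _) _))
  have := hu.sum_le π.monotone_clamp π.clamp_mem π.n
  rwa [π.clamp_zero, π.clamp_n] at this

end Variation

/-! ### The second level of a rough path acting on bilinear maps -/

section Contract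

variable {d : ℕ} {G : Type*} [NormedAddCommGroup G] [NormedSpace ℝ G]

theorem sum_mul_smul_apply_single
    (B : EuclideanSpace ℝ (Fin d) →L[ℝ] EuclideanSpace ℝ (Fin d) →L[ℝ] G)
    (x y : EuclideanSpace ℝ (Fin d)) :
    ∑ i : Fin d, ∑ j : Fin d, (x i * y j) •
      B (EuclideanSpace.single i (1 : ℝ)) (EuclideanSpace.single j (1 : ℝ)) = B x y := by
  have h : ∀ z : EuclideanSpace ℝ (Fin d),
      z = ∑ i : Fin d, z i • EuclideanSpace.single i (1 : ℝ) := by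
    intro z
    conv_lhs => rw [← (EuclideanSpace.basisFun (Fin d) ℝ).sum_repr z]
    simp
  conv_rhs => rw [h x, h y]
  simp only [map_sum, map_smul, sum_apply, smul_apply,
    Finset.smul_sum, smul_smul]
  rw [Finset.sum_comm]
  simp only [mul_comm]

theorem bilinearContract_chen
    (B : EuclideanSpace ℝ (Fin d) →L[ℝ] EuclideanSpace ℝ (Fin d) →L[ℝ] G)
    {M M₁ M₂ : EuclideanSpace ℝ (Fin d × Fin d)} {x y : EuclideanSpace ℝ (Fin d)}
    (h : ∀ i j, M (i, j) = M₁ (i, j) + M₂ (i, j) + x i * y j) :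
    bilinearContract B M = bilinearContract B M₁ + bilinearContract B M₂ + B x y := by
  rw [← sum_mul_smul_apply_single B x y]
  simp only [bilinearContract, h, add_smul, Finset.sum_add_distrib]

theorem norm_sum_smul_le (M : EuclideanSpace ℝ (Fin d × Fin d)) (c : Fin d → Fin d → G) {K : ℝ}
    (hc : ∀ i j, ‖c i j‖ ≤ K) :
    ‖∑ i : Fin d, ∑ j : Fin d, M (i, j) • c i j‖ ≤ d ^ 2 * K * ‖M‖ := by
  have h1 : ∀ i j, ‖M (i, j) • c i j‖ ≤ ‖M‖ * K := fun i j => by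
    rw [norm_smul]
    exact mul_le_mul (PiLp.norm_apply_le M (i, j)) (hc i j) (norm_nonneg _) (norm_nonneg _)
  calc _ ≤ ∑ i : Fin d, ∑ j : Fin d, ‖M‖ * K :=
        (norm_sum_le _ _).trans (Finset.sum_le_sum fun i _ =>
          (norm_sum_le _ _).trans (Finset.sum_le_sum fun j _ => h1 i j))
    _ = _ := by simp; ring

end Contract

/-! ### The one-step map of a linear rough differential equation -/

section Step

set_option maxSynthPendingDepth 3

variable {d : ℕ} {E : Type*} [NormedAddCommGroup E] [NormedSpace ℝ E]

/-- The coefficient of the `(i, j)`-component of the second level in the one-step map. -/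
noncomputable def stepCoeff (S : E →L[ℝ] EuclideanSpace ℝ (Fin d) →L[ℝ] E)
    (S' : EuclideanSpace ℝ (Fin d) →L[ℝ] E →L[ℝ] EuclideanSpace ℝ (Fin d) →L[ℝ] E)
    (i j : Fin d) : E →L[ℝ] E :=
  (S' (EuclideanSpace.single i (1 : ℝ))).flip (EuclideanSpace.single j (1 : ℝ)) +
    S.flip (EuclideanSpace.single j (1 : ℝ)) * S.flip (EuclideanSpace.single i (1 : ℝ))

/-- The second level of the one-step map. -/
noncomputable def secondLevel (S : E →L[ℝ] EuclideanSpace ℝ (Fin d) →L[ℝ] E)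
    (S' : EuclideanSpace ℝ (Fin d) →L[ℝ] E →L[ℝ] EuclideanSpace ℝ (Fin d) →L[ℝ] E)
    (M : EuclideanSpace ℝ (Fin d × Fin d)) : E →L[ℝ] E :=
  ∑ i : Fin d, ∑ j : Fin d, M (i, j) • stepCoeff S S' i j

/-- At z = V_s, when V' = SV, the contracted bilinear map is the Gubinelli derivative of SV, so the
operator form and the integrand of the rough integral agree. -/
theorem secondLevel_apply (S : E →L[ℝ] EuclideanSpace ℝ (Fin d) →L[ℝ] E)
    (S' : EuclideanSpace ℝ (Fin d) →L[ℝ] E →L[ℝ] EuclideanSpace ℝ (Fin d) →L[ℝ] E)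
    (M : EuclideanSpace ℝ (Fin d × Fin d)) (z : E) :
    secondLevel S S' M z = bilinearContract (S'.flip z + S.comp (S z)) M := by
  simp [secondLevel, bilinearContract, stepCoeff]

theorem norm_flip_apply_le (S : E →L[ℝ] EuclideanSpace ℝ (Fin d) →L[ℝ] E)
    (x : EuclideanSpace ℝ (Fin d)) : ‖S.flip x‖ ≤ ‖S‖ * ‖x‖ := by
  simpa only [ContinuousLinearMap.opNorm_flip] using S.flip.le_opNorm x

theorem norm_flip_single_le (S : E →L[ℝ] EuclideanSpace ℝ (Fin d) →L[ℝ] E) (i : Fin d) :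
    ‖S.flip (EuclideanSpace.single i (1 : ℝ))‖ ≤ ‖S‖ := by
  simpa using norm_flip_apply_le S (EuclideanSpace.single i (1 : ℝ))

theorem norm_apply_flip_single_le
    (S' : EuclideanSpace ℝ (Fin d) →L[ℝ] E →L[ℝ] EuclideanSpace ℝ (Fin d) →L[ℝ] E)
    (i j : Fin d) :
    ‖(S' (EuclideanSpace.single i (1 : ℝ))).flip (EuclideanSpace.single j (1 : ℝ))‖ ≤ ‖S'‖ :=
  (norm_flip_single_le _ j).trans (by simpa using S'.le_opNorm (EuclideanSpace.single i (1 : ℝ)))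

theorem norm_stepCoeff_le (S : E →L[ℝ] EuclideanSpace ℝ (Fin d) →L[ℝ] E)
    (S' : EuclideanSpace ℝ (Fin d) →L[ℝ] E →L[ℝ] EuclideanSpace ℝ (Fin d) →L[ℝ] E)
    (i j : Fin d) : ‖stepCoeff S S' i j‖ ≤ ‖S'‖ + ‖S‖ * ‖S‖ :=
  (norm_add_le _ _).trans (add_le_add (norm_apply_flip_single_le S' i j)
    ((norm_mul_le _ _).trans (mul_le_mul (norm_flip_single_le S j) (norm_flip_single_le S i)
      (norm_nonneg _) (norm_nonneg _))))

theorem norm_stepCoeff_sub_le (S₁ S₂ : E →L[ℝ] EuclideanSpace ℝ (Fin d) →L[ℝ] E)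
    (S₁' S₂' : EuclideanSpace ℝ (Fin d) →L[ℝ] E →L[ℝ] EuclideanSpace ℝ (Fin d) →L[ℝ] E)
    (i j : Fin d) :
    ‖stepCoeff S₁ S₁' i j - stepCoeff S₂ S₂' i j‖ ≤
      ‖S₁' - S₂'‖ + (‖S₁‖ + ‖S₂‖) * ‖S₁ - S₂‖ := by
  have h : stepCoeff S₁ S₁' i j - stepCoeff S₂ S₂' i j =
      ((S₁' - S₂') (EuclideanSpace.single i (1 : ℝ))).flip (EuclideanSpace.single j (1 : ℝ)) +
      (S₁.flip (EuclideanSpace.single j (1 : ℝ)) *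
          (S₁ - S₂).flip (EuclideanSpace.single i (1 : ℝ)) +
        (S₁ - S₂).flip (EuclideanSpace.single j (1 : ℝ)) *
          S₂.flip (EuclideanSpace.single i (1 : ℝ))) := by
    ext z
    simp [stepCoeff]
    abel
  rw [h]
  refine (norm_add_le _ _).trans (add_le_add (norm_apply_flip_single_le _ i j) ?_)
  refine (norm_add_le _ _).trans ?_
  calc _ ≤ ‖S₁‖ * ‖S₁ - S₂‖ + ‖S₁ - S₂‖ * ‖S₂‖ := by
        refine add_le_add ((norm_mul_le _ _).trans ?_) ((norm_mul_le _ _).trans ?_)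
        · exact mul_le_mul (norm_flip_single_le _ j) (norm_flip_single_le _ i)
            (norm_nonneg _) (norm_nonneg _)
        · exact mul_le_mul (norm_flip_single_le _ j) (norm_flip_single_le _ i)
            (norm_nonneg _) (norm_nonneg _)
    _ = _ := by ring

variable (X : ℝ → EuclideanSpace ℝ (Fin d)) (XX : ℝ → ℝ → EuclideanSpace ℝ (Fin d × Fin d))
  (S : ℝ → E →L[ℝ] EuclideanSpace ℝ (Fin d) →L[ℝ] E)
  (S' : ℝ → EuclideanSpace ℝ (Fin d) →L[ℝ] E →L[ℝ] EuclideanSpace ℝ (Fin d) →L[ℝ] E)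

/-- The germ of the rough integral `∫ S V d𝐗` for a solution, as a linear function of `V_s`. -/
noncomputable def roughStep (s t : ℝ) : E →L[ℝ] E :=
  (S s).flip (pathIncrement X s t) + secondLevel (S s) (S' s) (XX s t)

/-- The left side is the defect of multiplicativity of 1 + `roughStep`. Chen's relation produces a
cross term in X_{s,r} and X_{r,t}: its S' part cancels the leading part of S_{s,r} X_{r,t}, its S S
part the leading part of the product. Counting X and increments of S, S' as order one, and XX and
the remainder of S as order two, every surviving term has order at least three. -/
theorem roughStep_defect {s r t : ℝ}
    (chen : ∀ i j : Fin d, XX s t (i, j) =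
      XX s r (i, j) + XX r t (i, j) + (X r i - X s i) * (X t j - X r j)) :
    roughStep X XX S S' s r + roughStep X XX S S' r t - roughStep X XX S S' s t +
        roughStep X XX S S' r t * roughStep X XX S S' s r =
      (controlledRemainder X S S' s r).flip (pathIncrement X r t) +
      (∑ i : Fin d, ∑ j : Fin d,
        XX r t (i, j) • (stepCoeff (S r) (S' r) i j - stepCoeff (S s) (S' s) i j)) +
      (pathIncrement S s r).flip (pathIncrement X r t) * (S s).flip (pathIncrement X s r) +
      ((S r).flip (pathIncrement X r t) * secondLevel (S s) (S' s) (XX s r) +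
        secondLevel (S r) (S' r) (XX r t) * roughStep X XX S S' s r) := by
  have h1 : (∑ i : Fin d, ∑ j : Fin d,
        XX r t (i, j) • (stepCoeff (S r) (S' r) i j - stepCoeff (S s) (S' s) i j)) =
      secondLevel (S r) (S' r) (XX r t) - secondLevel (S s) (S' s) (XX r t) := by
    simp only [secondLevel, smul_sub, Finset.sum_sub_distrib]
  rw [h1]
  ext1 z
  have h2 := bilinearContract_chen ((S' s).flip z + (S s).comp (S s z))
    (M := XX s t) (M₁ := XX s r) (M₂ := XX r t) (x := pathIncrement X s r)
    (y := pathIncrement X r t) (fun i j => by rw [chen i j]; simp [pathIncrement])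
  have h3 : pathIncrement X s t = pathIncrement X s r + pathIncrement X r t := by
    simp [pathIncrement]
  simp only [roughStep, add_apply, sub_apply, mul_apply_eq_comp,
    ContinuousLinearMap.flip_apply, secondLevel_apply _ _ (XX s t), h2, h3, map_add, add_mul,
    controlledRemainder]
  simp only [secondLevel_apply, ContinuousLinearMap.comp_apply]
  simp only [pathIncrement, sub_apply]
  abel

end Step

/-! ### Estimates for the one-step map under a common control -/

section Drive

set_option maxSynthPendingDepth 3

variable {d : ℕ} {E : Type*} [NormedAddCommGroup E] [NormedSpace ℝ E]

/-- The data of a linear rough differential equation, with all increments dominated by the control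
`w` in the sense of `q`-variation and all coefficients bounded by `N`. -/
structure IsDominated (T q N : ℝ) (w : ℝ → ℝ → ℝ) (A : ℝ → E →L[ℝ] E)
    (X : ℝ → EuclideanSpace ℝ (Fin d)) (XX : ℝ → ℝ → EuclideanSpace ℝ (Fin d × Fin d))
    (S : ℝ → E →L[ℝ] EuclideanSpace ℝ (Fin d) →L[ℝ] E)
    (S' : ℝ → EuclideanSpace ℝ (Fin d) →L[ℝ] E →L[ℝ] EuclideanSpace ℝ (Fin d) →L[ℝ] E) :
    Prop where
  control : IsControl T w
  chen : ∀ s ∈ Icc 0 T, ∀ r ∈ Icc 0 T, ∀ t ∈ Icc 0 T, ∀ i j : Fin d,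
    XX s t (i, j) = XX s r (i, j) + XX r t (i, j) + (X r i - X s i) * (X t j - X r j)
  norm_path : ∀ s t, 0 ≤ s → s ≤ t → t ≤ T → ‖pathIncrement X s t‖ ≤ w s t ^ (1 / q)
  norm_second : ∀ s t, 0 ≤ s → s ≤ t → t ≤ T → ‖XX s t‖ ≤ (w s t ^ (1 / q)) ^ 2
  norm_coeff : ∀ s t, 0 ≤ s → s ≤ t → t ≤ T → ‖pathIncrement S s t‖ ≤ w s t ^ (1 / q)
  norm_deriv : ∀ s t, 0 ≤ s → s ≤ t → t ≤ T → ‖pathIncrement S' s t‖ ≤ w s t ^ (1 / q)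
  norm_remainder : ∀ s t, 0 ≤ s → s ≤ t → t ≤ T →
    ‖controlledRemainder X S S' s t‖ ≤ (w s t ^ (1 / q)) ^ 2
  length_le : ∀ s t, 0 ≤ s → s ≤ t → t ≤ T → t - s ≤ w s t
  coeff_le : ∀ s ∈ Icc 0 T, ‖S s‖ ≤ N
  deriv_le : ∀ s ∈ Icc 0 T, ‖S' s‖ ≤ N
  drift_meas : AEStronglyMeasurable A (volume.restrict (Icc 0 T))
  drift_le : ∀ᵐ r ∂(volume.restrict (Icc 0 T)), ‖A r‖ ≤ N

/-- The one-step map of the linear rough differential equation. -/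
noncomputable def rdeStep (A : ℝ → E →L[ℝ] E)
    (X : ℝ → EuclideanSpace ℝ (Fin d)) (XX : ℝ → ℝ → EuclideanSpace ℝ (Fin d × Fin d))
    (S : ℝ → E →L[ℝ] EuclideanSpace ℝ (Fin d) →L[ℝ] E)
    (S' : ℝ → EuclideanSpace ℝ (Fin d) →L[ℝ] E →L[ℝ] EuclideanSpace ℝ (Fin d) →L[ℝ] E)
    (s t : ℝ) : E →L[ℝ] E :=
  1 + (∫ r in s..t, A r) + roughStep X XX S S' s t

theorem rpow_one_div_pow {x : ℝ} (hx : 0 ≤ x) (q : ℝ) (k : ℕ) :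
    (x ^ (1 / q)) ^ k = x ^ (k / q : ℝ) := by
  rw [← Real.rpow_natCast, ← Real.rpow_mul hx]; congr 1; ring

theorem rpow_le_mul_rpow {x U a b : ℝ} (hx : 0 ≤ x) (hU : x ≤ U) (ha : 0 < a) (hab : a ≤ b) :
    x ^ b ≤ U ^ (b - a) * x ^ a := by
  have e : b = (b - a) + a := by ring
  nth_rewrite 1 [e]
  rw [Real.rpow_add_of_nonneg hx (by linarith) ha.le]
  have := Real.rpow_le_rpow hx hU (sub_nonneg.2 hab)
  gcongr

namespace IsDominated

variable {T q N : ℝ} {w : ℝ → ℝ → ℝ} {A : ℝ → E →L[ℝ] E}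
  {X : ℝ → EuclideanSpace ℝ (Fin d)} {XX : ℝ → ℝ → EuclideanSpace ℝ (Fin d × Fin d)}
  {S : ℝ → E →L[ℝ] EuclideanSpace ℝ (Fin d) →L[ℝ] E}
  {S' : ℝ → EuclideanSpace ℝ (Fin d) →L[ℝ] E →L[ℝ] EuclideanSpace ℝ (Fin d) →L[ℝ] E}

/-- Allows the control of the data to be enlarged so that it also dominates the solutions under
consideration. -/
theorem mono (h : IsDominated T q N w A X XX S S') (hq : 0 < q) {w' : ℝ → ℝ → ℝ}
    (hw' : IsControl T w') (hle : ∀ s t, w s t ≤ w' s t) :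
    IsDominated T q N w' A X XX S S' := by
  have hp : ∀ s t, w s t ^ (1 / q) ≤ w' s t ^ (1 / q) := fun s t =>
    Real.rpow_le_rpow (h.control.nonneg s t) (hle s t) (one_div_pos.2 hq).le
  have hp2 : ∀ s t, (w s t ^ (1 / q)) ^ 2 ≤ (w' s t ^ (1 / q)) ^ 2 := fun s t =>
    pow_le_pow_left₀ (Real.rpow_nonneg (h.control.nonneg s t) _) (hp s t) 2
  exact
  { control := hw'
    chen := h.chen
    norm_path := fun s t h0 h1 h2 => (h.norm_path s t h0 h1 h2).trans (hp s t)
    norm_second := fun s t h0 h1 h2 => (h.norm_second s t h0 h1 h2).trans (hp2 s t)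
    norm_coeff := fun s t h0 h1 h2 => (h.norm_coeff s t h0 h1 h2).trans (hp s t)
    norm_deriv := fun s t h0 h1 h2 => (h.norm_deriv s t h0 h1 h2).trans (hp s t)
    norm_remainder := fun s t h0 h1 h2 => (h.norm_remainder s t h0 h1 h2).trans (hp2 s t)
    length_le := fun s t h0 h1 h2 => (h.length_le s t h0 h1 h2).trans (hle s t)
    coeff_le := h.coeff_le
    deriv_le := h.deriv_le
    drift_meas := h.drift_meas
    drift_le := h.drift_le }

theorem scale_nonneg (h : IsDominated T q N w A X XX S S') (s t : ℝ) : 0 ≤ w s t ^ (1 / q) :=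
  Real.rpow_nonneg (h.control.nonneg s t) _

theorem scale_mono (h : IsDominated T q N w A X XX S S') (hq : 0 < q) {s s' t' t : ℝ}
    (h0 : 0 ≤ s) (h1 : s ≤ s') (h2 : s' ≤ t') (h3 : t' ≤ t) (h4 : t ≤ T) :
    w s' t' ^ (1 / q) ≤ w s t ^ (1 / q) :=
  Real.rpow_le_rpow (h.control.nonneg _ _) (h.control.mono h0 h1 h2 h3 h4) (one_div_pos.2 hq).le

/-- Time counts as order two: w ≤ w(0,T)^(1-2/q) w^(2/q) because q ≥ 2. -/
theorem length_le_scale (h : IsDominated T q N w A X XX S S') (hq : 2 ≤ q) :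
    ∃ L ≥ 0, ∀ s t, 0 ≤ s → s ≤ t → t ≤ T → t - s ≤ L * (w s t ^ (1 / q)) ^ 2 := by
  refine ⟨w 0 T ^ (1 - 2 / q), Real.rpow_nonneg (h.control.nonneg _ _) _, fun s t h0 h1 h2 => ?_⟩
  have h3 := h.control.mono le_rfl h0 h1 h2 le_rfl
  have hn := h.control.nonneg s t
  refine (h.length_le s t h0 h1 h2).trans ?_
  rw [rpow_one_div_pow hn]
  have := rpow_le_mul_rpow hn h3 (a := 2 / q) (b := 1) (by positivity)
    ((div_le_one (by linarith)).2 hq)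
  simpa using this

theorem bound_nonneg (h : IsDominated T q N w A X XX S S') (hT : 0 ≤ T) : 0 ≤ N :=
  (norm_nonneg _).trans (h.coeff_le 0 ⟨le_rfl, hT⟩)

theorem norm_secondLevel_le (h : IsDominated T q N w A X XX S S') {s : ℝ} (hs : s ∈ Icc 0 T)
    (M : EuclideanSpace ℝ (Fin d × Fin d)) :
    ‖secondLevel (S s) (S' s) M‖ ≤ d ^ 2 * (N + N * N) * ‖M‖ := by
  have hN : 0 ≤ N := (norm_nonneg _).trans (h.coeff_le s hs)
  refine norm_sum_smul_le M _ fun i j => (norm_stepCoeff_le _ _ i j).trans ?_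
  have := h.coeff_le s hs
  have := h.deriv_le s hs
  gcongr

theorem norm_roughStep_le (h : IsDominated T q N w A X XX S S') {s : ℝ} (hs : s ∈ Icc 0 T)
    (t : ℝ) : ‖roughStep X XX S S' s t‖ ≤
      N * ‖pathIncrement X s t‖ + d ^ 2 * (N + N * N) * ‖XX s t‖ :=
  (norm_add_le _ _).trans (add_le_add ((norm_flip_apply_le _ _).trans
    (mul_le_mul_of_nonneg_right (h.coeff_le s hs) (norm_nonneg _))) (h.norm_secondLevel_le hs _))

theorem norm_roughStep_le_scale (h : IsDominated T q N w A X XX S S') (hT : 0 ≤ T) (hq : 0 < q) :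
    ∃ C ≥ 0, ∀ s t, 0 ≤ s → s ≤ t → t ≤ T → ‖roughStep X XX S S' s t‖ ≤ C * w s t ^ (1 / q) := by
  have hN := h.bound_nonneg hT
  have hU := h.scale_nonneg 0 T
  refine ⟨N + d ^ 2 * (N + N * N) * w 0 T ^ (1 / q), by positivity, fun s t h0 h1 h2 => ?_⟩
  have hx := h.scale_nonneg s t
  have hxU := h.scale_mono hq le_rfl h0 h1 h2 le_rfl
  set x := w s t ^ (1 / q)
  calc _ ≤ N * x + d ^ 2 * (N + N * N) * (x ^ 2) := by
        refine (h.norm_roughStep_le ⟨h0, h1.trans h2⟩ t).trans ?_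
        have := h.norm_path s t h0 h1 h2
        have := h.norm_second s t h0 h1 h2
        gcongr
    _ ≤ N * x + d ^ 2 * (N + N * N) * (w 0 T ^ (1 / q) * x) := by
        rw [pow_two x]; gcongr
    _ = _ := by ring

theorem norm_roughStep_defect_le (h : IsDominated T q N w A X XX S S') (hT : 0 ≤ T)
    (hq : 0 < q) :
    ∃ C ≥ 0, ∀ s r t, 0 ≤ s → s ≤ r → r ≤ t → t ≤ T →
      ‖roughStep X XX S S' s r + roughStep X XX S S' r t - roughStep X XX S S' s t +
        roughStep X XX S S' r t * roughStep X XX S S' s r‖ ≤ C * (w s t ^ (1 / q)) ^ 3 := by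
  have hN := h.bound_nonneg hT
  obtain ⟨B, hB0, hB⟩ := h.norm_roughStep_le_scale hT hq
  set K := d ^ 2 * (N + N * N) with hK
  have hK0 : 0 ≤ K := by positivity
  -- The coefficients of x^3 in the bounds `e1` to `e5`, in this order.
  refine ⟨1 + d ^ 2 * (1 + (N + N) * 1) + N + (N * K + K * B), by positivity,
    fun s r t h0 h1 h2 h3 => ?_⟩
  have hs : s ∈ Icc 0 T := ⟨h0, h1.trans (h2.trans h3)⟩
  have hr : r ∈ Icc 0 T := ⟨h0.trans h1, h2.trans h3⟩
  have ht : t ∈ Icc 0 T := ⟨hr.1.trans h2, h3⟩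
  have hx := h.scale_nonneg s t
  have m1 := h.scale_mono hq h0 le_rfl h1 h2 h3
  have m2 := h.scale_mono hq h0 h1 h2 le_rfl h3
  have m1' := pow_le_pow_left₀ (h.scale_nonneg s r) m1 2
  have m2' := pow_le_pow_left₀ (h.scale_nonneg r t) m2 2
  have p1 := (h.norm_path s r h0 h1 hr.2).trans m1
  have p2 := (h.norm_path r t hr.1 h2 h3).trans m2
  have q1 := (h.norm_second s r h0 h1 hr.2).trans m1'
  have q2 := (h.norm_second r t hr.1 h2 h3).trans m2'
  have c1 := (h.norm_coeff s r h0 h1 hr.2).trans m1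
  have d1 := (h.norm_deriv s r h0 h1 hr.2).trans m1
  have r1 := (h.norm_remainder s r h0 h1 hr.2).trans m1'
  have b1 := (hB s r h0 h1 hr.2).trans (mul_le_mul_of_nonneg_left m1 hB0)
  have l1 := (h.norm_secondLevel_le hs (XX s r)).trans (mul_le_mul_of_nonneg_left q1 hK0)
  have l2 := (h.norm_secondLevel_le hr (XX r t)).trans (mul_le_mul_of_nonneg_left q2 hK0)
  have n1 := h.coeff_le s hs
  have n2 := h.coeff_le r hr
  rw [roughStep_defect X XX S S' (h.chen s hs r hr t ht)]
  set x := w s t ^ (1 / q)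
  have e1 : ‖(controlledRemainder X S S' s r).flip (pathIncrement X r t)‖ ≤ x ^ 2 * x :=
    (norm_flip_apply_le _ _).trans (by gcongr)
  have e2 : ‖∑ i : Fin d, ∑ j : Fin d,
        XX r t (i, j) • (stepCoeff (S r) (S' r) i j - stepCoeff (S s) (S' s) i j)‖ ≤
      d ^ 2 * (x + (N + N) * x) * x ^ 2 := by
    refine (norm_sum_smul_le (XX r t) _ (K := x + (N + N) * x) fun i j =>
      (norm_stepCoeff_sub_le _ _ _ _ i j).trans ?_).trans ?_
    · exact add_le_add d1 (mul_le_mul (add_le_add n2 n1) c1 (norm_nonneg _) (by positivity))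
    · gcongr
  have e3 : ‖(pathIncrement S s r).flip (pathIncrement X r t) *
      (S s).flip (pathIncrement X s r)‖ ≤ (x * x) * (N * x) :=
    (norm_mul_le _ _).trans (mul_le_mul ((norm_flip_apply_le _ _).trans (by gcongr))
      ((norm_flip_apply_le _ _).trans (by gcongr)) (norm_nonneg _) (by positivity))
  have e4 : ‖(S r).flip (pathIncrement X r t) * secondLevel (S s) (S' s) (XX s r)‖ ≤
      (N * x) * (K * x ^ 2) :=
    (norm_mul_le _ _).trans (mul_le_mul ((norm_flip_apply_le _ _).trans (by gcongr)) l1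
      (norm_nonneg _) (by positivity))
  have e5 : ‖secondLevel (S r) (S' r) (XX r t) * roughStep X XX S S' s r‖ ≤
      (K * x ^ 2) * (B * x) :=
    (norm_mul_le _ _).trans (mul_le_mul l2 b1 (norm_nonneg _) (by positivity))
  refine norm_add₄_le.trans ?_
  calc _ ≤ x ^ 2 * x + d ^ 2 * (x + (N + N) * x) * x ^ 2 + (x * x) * (N * x) +
        ((N * x) * (K * x ^ 2) + (K * x ^ 2) * (B * x)) :=
        add_le_add (add_le_add (add_le_add e1 e2) e3) ((norm_add_le _ _).trans (add_le_add e4 e5))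
    _ = _ := by ring

/-! #### The drift -/

theorem norm_integral_le (h : IsDominated T q N w A X XX S S') {s t K : ℝ}
    (h0 : 0 ≤ s) (h1 : s ≤ t) (h2 : t ≤ T) {g : ℝ → E} (hg : ∀ r ∈ Icc s t, ‖g r‖ ≤ K) :
    ‖∫ r in s..t, A r (g r)‖ ≤ N * K * (t - s) := by
  have h3 := h.drift_le
  rw [ae_restrict_iff' measurableSet_Icc] at h3
  have := intervalIntegral.norm_integral_le_of_norm_le_const_ae (a := s) (b := t)
    (f := fun r => A r (g r)) (C := N * K) (by
      filter_upwards [h3] with r hr hrst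
      rw [uIoc_of_le h1] at hrst
      have hr' : r ∈ Icc s t := Ioc_subset_Icc_self hrst
      have hA := hr ⟨h0.trans hr'.1, hr'.2.trans h2⟩
      exact (ContinuousLinearMap.le_opNorm _ _).trans
        (mul_le_mul hA (hg r hr') (norm_nonneg _) ((norm_nonneg _).trans hA)))
  rwa [abs_of_nonneg (by linarith)] at this

theorem norm_integral_drift_le (h : IsDominated T q N w A X XX S S') {s t : ℝ}
    (h0 : 0 ≤ s) (h1 : s ≤ t) (h2 : t ≤ T) : ‖∫ r in s..t, A r‖ ≤ N * (t - s) := by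
  have h3 := h.drift_le
  rw [ae_restrict_iff' measurableSet_Icc] at h3
  have := intervalIntegral.norm_integral_le_of_norm_le_const_ae (a := s) (b := t)
    (f := A) (C := N) (by
      filter_upwards [h3] with r hr hrst
      rw [uIoc_of_le h1] at hrst
      exact hr ⟨h0.trans hrst.1.le, hrst.2.trans h2⟩)
  rwa [abs_of_nonneg (by linarith)] at this

theorem intervalIntegrable_drift (h : IsDominated T q N w A X XX S S') {s t : ℝ}
    (hs : s ∈ Icc 0 T) (ht : t ∈ Icc 0 T) : IntervalIntegrable A volume s t := by
  have : IntegrableOn A (Icc 0 T) :=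
    Integrable.mono' (integrable_const N) h.drift_meas h.drift_le
  exact (this.mono_set (uIcc_subset_Icc hs ht)).intervalIntegrable

theorem intervalIntegrable_drift_apply (h : IsDominated T q N w A X XX S S') {V : ℝ → E} {M : ℝ}
    (hV : ContinuousOn V (Icc 0 T)) (hM : ∀ t ∈ Icc 0 T, ‖V t‖ ≤ M) {s t : ℝ}
    (hs : s ∈ Icc 0 T) (ht : t ∈ Icc 0 T) :
    IntervalIntegrable (fun r => A r (V r)) volume s t := by
  have hmeas : AEStronglyMeasurable V (volume.restrict (Icc 0 T)) :=
    hV.aestronglyMeasurable_of_isCompact isCompact_Icc measurableSet_Icc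
  have : IntegrableOn (fun r => A r (V r)) (Icc 0 T) := by
    refine Integrable.mono' (integrable_const (N * M)) ?_ ?_
    · exact isBoundedBilinearMap_apply.continuous.comp_aestronglyMeasurable
        (h.drift_meas.prodMk hmeas)
    · filter_upwards [h.drift_le, ae_restrict_mem measurableSet_Icc] with r hr hrT
      exact (ContinuousLinearMap.le_opNorm _ _).trans
        (mul_le_mul hr (hM r hrT) (norm_nonneg _) ((norm_nonneg _).trans hr))
  exact (this.mono_set (uIcc_subset_Icc hs ht)).intervalIntegrable

theorem norm_integral_drift_le_scale (h : IsDominated T q N w A X XX S S') (hT : 0 ≤ T)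
    (hq : 2 ≤ q) :
    ∃ C ≥ 0, ∀ s t, 0 ≤ s → s ≤ t → t ≤ T →
      ‖∫ r in s..t, A r‖ ≤ C * (w s t ^ (1 / q)) ^ 2 := by
  have hN := h.bound_nonneg hT
  obtain ⟨L, hL0, hL⟩ := h.length_le_scale hq
  refine ⟨N * L, by positivity, fun s t h0 h1 h2 => (h.norm_integral_drift_le h0 h1 h2).trans ?_⟩
  rw [mul_assoc]
  exact mul_le_mul_of_nonneg_left (hL s t h0 h1 h2) hN

theorem norm_rdeStep_sub_one_le (h : IsDominated T q N w A X XX S S') (hT : 0 ≤ T) (hq : 2 ≤ q) :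
    ∃ C ≥ 0, ∀ s t, 0 ≤ s → s ≤ t → t ≤ T → ‖rdeStep A X XX S S' s t - 1‖ ≤ C * w s t ^ (1 / q) := by
  obtain ⟨B, hB0, hB⟩ := h.norm_roughStep_le_scale hT (by linarith)
  obtain ⟨C, hC0, hC⟩ := h.norm_integral_drift_le_scale hT hq
  have hU := h.scale_nonneg 0 T
  refine ⟨C * w 0 T ^ (1 / q) + B, by positivity, fun s t h0 h1 h2 => ?_⟩
  have hx := h.scale_nonneg s t
  have hxU := h.scale_mono (by linarith) le_rfl h0 h1 h2 le_rfl
  have e : rdeStep A X XX S S' s t - 1 = (∫ r in s..t, A r) + roughStep X XX S S' s t := by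
    unfold rdeStep; abel
  rw [e]
  refine (norm_add_le _ _).trans ((add_le_add (hC s t h0 h1 h2) (hB s t h0 h1 h2)).trans ?_)
  rw [add_mul, pow_two, mul_assoc]
  gcongr

theorem rdeStep_self (h : IsDominated T q N w A X XX S S') {s : ℝ} (hs : s ∈ Icc 0 T) :
    rdeStep A X XX S S' s s = 1 := by
  have h0 : ∀ i j : Fin d, XX s s (i, j) = 0 := fun i j => by
    have := h.chen s hs s hs s hs i j
    simp only [sub_self, mul_zero, add_zero] at this
    linarith
  simp [rdeStep, roughStep, secondLevel, pathIncrement, h0]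

/-- The drift has order two and the rough step order one, so each product involving the drift has
order at least three; the purely rough part is `norm_roughStep_defect_le`. -/
theorem isAlmostMultiplicative (h : IsDominated T q N w A X XX S S') (hT : 0 ≤ T) (hq : 2 ≤ q) :
    IsAlmostMultiplicative T (3 / q) w (rdeStep A X XX S S') := by
  have hq0 : 0 < q := by linarith
  obtain ⟨B, hB0, hB⟩ := h.norm_rdeStep_sub_one_le hT hq
  have hJ : ∀ s t, 0 ≤ s → s ≤ t → t ≤ T → ‖rdeStep A X XX S S' s t‖ ≤ 1 + B * w s t ^ (1 / q) := by
    intro s t h0 h1 h2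
    have h3 := norm_le_norm_add_norm_sub' (rdeStep A X XX S S' s t) 1
    have h4 : ‖(1 : E →L[ℝ] E)‖ ≤ 1 := ContinuousLinearMap.norm_id_le
    have := hB s t h0 h1 h2
    linarith
  refine ⟨fun s => h.rdeStep_self, fun η hη => ?_, ?_, ?_⟩
  · refine ⟨(η / (B + 1)) ^ q, by positivity, fun s t h0 h1 h2 h3 => (hJ s t h0 h1 h2).trans ?_⟩
    have h4 : w s t ^ (1 / q) ≤ η / (B + 1) := by
      refine (Real.rpow_le_rpow (h.control.nonneg s t) h3 (one_div_pos.2 hq0).le).trans (le_of_eq ?_)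
      rw [← Real.rpow_mul (by positivity), mul_one_div_cancel hq0.ne', Real.rpow_one]
    have h5 : B * w s t ^ (1 / q) ≤ (B + 1) * (η / (B + 1)) :=
      mul_le_mul (by linarith) h4 (h.scale_nonneg s t) (by positivity)
    rw [mul_div_cancel₀ _ (by positivity)] at h5
    linarith
  · refine ⟨1 + B * w 0 T ^ (1 / q), fun s t h0 h1 h2 => (hJ s t h0 h1 h2).trans ?_⟩
    have := h.scale_mono hq0 le_rfl h0 h1 h2 le_rfl
    gcongr
  · obtain ⟨D, hD0, hD⟩ := h.norm_roughStep_defect_le hT hq0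
    obtain ⟨R, hR0, hR⟩ := h.norm_roughStep_le_scale hT hq0
    obtain ⟨C, hC0, hC⟩ := h.norm_integral_drift_le_scale hT hq
    refine ⟨D + (C * C * w 0 T ^ (1 / q) + C * R + R * C), fun s r t h0 h1 h2 h3 => ?_⟩
    have h4 := hD s r t h0 h1 h2 h3
    have hx := h.scale_nonneg s t
    have hxU := h.scale_mono hq0 le_rfl h0 (h1.trans h2) h3 le_rfl
    have m1 := h.scale_mono hq0 h0 le_rfl h1 h2 h3
    have m2 := h.scale_mono hq0 h0 h1 h2 le_rfl h3
    have m1' := pow_le_pow_left₀ (h.scale_nonneg s r) m1 2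
    have m2' := pow_le_pow_left₀ (h.scale_nonneg r t) m2 2
    have hr0 := h0.trans h1
    have hrT := h2.trans h3
    have a1 := (hC s r h0 h1 hrT).trans (mul_le_mul_of_nonneg_left m1' hC0)
    have a2 := (hC r t hr0 h2 h3).trans (mul_le_mul_of_nonneg_left m2' hC0)
    have b1 := (hR s r h0 h1 hrT).trans (mul_le_mul_of_nonneg_left m1 hR0)
    have b2 := (hR r t hr0 h2 h3).trans (mul_le_mul_of_nonneg_left m2 hR0)
    have hadd := intervalIntegral.integral_add_adjacent_intervals
      (h.intervalIntegrable_drift ⟨h0, h1.trans hrT⟩ ⟨hr0, hrT⟩)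
      (h.intervalIntegrable_drift ⟨hr0, hrT⟩ ⟨hr0.trans h2, h3⟩)
    have e3 : (3 : ℝ) = (3 : ℕ) := by norm_num
    rw [e3, ← rpow_one_div_pow (h.control.nonneg s t)]
    unfold rdeStep
    rw [← hadd]
    generalize (∫ u in s..r, A u) = a at *
    generalize (∫ u in r..t, A u) = a' at *
    generalize roughStep X XX S S' s r = b at *
    generalize roughStep X XX S S' r t = b' at *
    generalize roughStep X XX S S' s t = b'' at *
    set x := w s t ^ (1 / q)
    -- The drift integral is additive, so it survives only inside products.
    have e : (1 + a' + b') * (1 + a + b) - (1 + (a + a') + b'') =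
        (b + b' - b'' + b' * b) + (a' * a + a' * b + b' * a) := by noncomm_ring
    rw [e]
    calc _ ≤ D * x ^ 3 + ((C * x ^ 2) * (C * x ^ 2) + (C * x ^ 2) * (R * x) +
          (R * x) * (C * x ^ 2)) := by
          refine (norm_add_le _ _).trans (add_le_add h4 (norm_add₃_le.trans ?_))
          gcongr
          · exact (norm_mul_le _ _).trans (by gcongr)
          · exact (norm_mul_le _ _).trans (by gcongr)
          · exact (norm_mul_le _ _).trans (by gcongr)
      _ = D * x ^ 3 + (C * C * x + C * R + R * C) * x ^ 3 := by ring
      _ ≤ D * x ^ 3 + (C * C * w 0 T ^ (1 / q) + C * R + R * C) * x ^ 3 := by gcongr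
      _ = _ := by ring

/-- For a path of finite `q`-variation, freezing the path in the drift integral costs an error of
order three. -/
theorem norm_integral_sub_le (h : IsDominated T q N w A X XX S S') (hT : 0 ≤ T) (hq : 2 ≤ q)
    [CompleteSpace E] {V : ℝ → E} {M K : ℝ} (hK : 0 ≤ K)
    (hV : ContinuousOn V (Icc 0 T)) (hM : ∀ t ∈ Icc 0 T, ‖V t‖ ≤ M)
    (hVK : ∀ s t, 0 ≤ s → s ≤ t → t ≤ T → ‖V t - V s‖ ≤ K * w s t ^ (1 / q)) :
    ∃ C, ∀ s t, 0 ≤ s → s ≤ t → t ≤ T →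
      ‖(∫ r in s..t, A r (V r)) - (∫ r in s..t, A r) (V s)‖ ≤ C * w s t ^ (3 / q) := by
  have hN := h.bound_nonneg hT
  obtain ⟨L, hL0, hL⟩ := h.length_le_scale hq
  refine ⟨N * K * L, fun s t h0 h1 h2 => ?_⟩
  have hs : s ∈ Icc 0 T := ⟨h0, h1.trans h2⟩
  have ht : t ∈ Icc 0 T := ⟨h0.trans h1, h2⟩
  have hi := h.intervalIntegrable_drift hs ht
  rw [ContinuousLinearMap.intervalIntegral_apply hi,
    ← intervalIntegral.integral_sub (h.intervalIntegrable_drift_apply hV hM hs ht)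
      (h.intervalIntegrable_drift_apply continuousOn_const (fun _ _ => le_rfl) hs ht)]
  simp only [← map_sub]
  have hx := h.scale_nonneg s t
  refine (h.norm_integral_le (K := K * w s t ^ (1 / q)) h0 h1 h2 fun r hr =>
    (hVK s r h0 hr.1 (hr.2.trans h2)).trans (mul_le_mul_of_nonneg_left
      (h.scale_mono (by linarith) h0 le_rfl hr.1 hr.2 h2) hK)).trans ?_
  have e3 : (3 : ℝ) = (3 : ℕ) := by norm_num
  rw [e3, ← rpow_one_div_pow (h.control.nonneg s t)]
  calc _ ≤ N * (K * w s t ^ (1 / q)) * (L * (w s t ^ (1 / q)) ^ 2) := by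
        gcongr; exact hL s t h0 h1 h2
    _ = _ := by ring

end IsDominated

end Drive

/-! ### Controls for rough and controlled paths -/

section ControlsOfPaths

set_option maxSynthPendingDepth 3

variable {F : Type*} [NormedAddCommGroup F] {d : ℕ} {p q T : ℝ}

theorem norm_pathIncrement_small {Y : ℝ → F} (hY : ContinuousOn Y (Icc 0 T)) :
    ∀ ε > 0, ∃ δ > 0, ∀ s t, 0 ≤ s → s ≤ t → t ≤ T → t - s < δ → ‖pathIncrement Y s t‖ ≤ ε := by
  intro ε hε
  obtain ⟨δ, hδ, h⟩ := Metric.uniformContinuousOn_iff.1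
    (isCompact_Icc.uniformContinuousOn_of_continuous hY) ε hε
  refine ⟨δ, hδ, fun s t h0 h1 h2 h3 => ?_⟩
  have := h t ⟨h0.trans h1, h2⟩ s ⟨h0, h1.trans h2⟩
    (by rwa [Real.dist_eq, abs_of_nonneg (by linarith)])
  rw [dist_eq_norm] at this
  exact this.le

theorem IsVariationPath.exists_isControl {Y : ℝ → F} (hY : IsVariationPath p T Y) (hp : 0 < p)
    (hpq : p < q) :
    ∃ w, IsControl T w ∧
      ∀ s t, 0 ≤ s → s ≤ t → t ≤ T → ‖pathIncrement Y s t‖ ≤ w s t ^ (1 / q) :=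
  exists_isControl_of_pVariation hp hpq hY.finite (norm_pathIncrement_small hY.continuousOn)

theorem rpow_one_div_half {x : ℝ} (hx : 0 ≤ x) (q : ℝ) :
    x ^ (1 / (q / 2)) = (x ^ (1 / q)) ^ 2 := by
  rw [rpow_one_div_pow hx]; congr 1; rw [one_div_div]; norm_num

theorem IsRoughPath.exists_isControl {X : ℝ → EuclideanSpace ℝ (Fin d)}
    {XX : ℝ → ℝ → EuclideanSpace ℝ (Fin d × Fin d)} (hX : IsRoughPath p T X XX) (hp : 0 < p)
    (hpq : p < q) :
    ∃ w, IsControl T w ∧ ∀ s t, 0 ≤ s → s ≤ t → t ≤ T → ‖XX s t‖ ≤ (w s t ^ (1 / q)) ^ 2 := by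
  obtain ⟨w, hw, h⟩ := exists_isControl_of_pVariation (α := p / 2) (β := q / 2) (by linarith)
    (by linarith) hX.finite (by
      intro ε hε
      obtain ⟨δ, hδ, h⟩ := Metric.uniformContinuousOn_iff.1
        ((isCompact_Icc.prod isCompact_Icc).uniformContinuousOn_of_continuous hX.continuousOn) ε hε
      refine ⟨δ, hδ, fun s t h0 h1 h2 h3 => ?_⟩
      have hs : s ∈ Icc 0 T := ⟨h0, h1.trans h2⟩
      have := h (s, t) ⟨hs, h0.trans h1, h2⟩ (s, s) ⟨hs, hs⟩
        (by rw [Prod.dist_eq, dist_self, Real.dist_eq, abs_of_nonneg (by linarith)]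
            exact max_lt hδ h3)
      -- Chen's relation at three equal times. Uniform continuity of `XX` then gives smallness near
      -- the diagonal.
      have h4 : XX s s = 0 := by
        ext ⟨i, j⟩
        have := hX.chen s hs s hs s hs i j
        simp only [sub_self, mul_zero, add_zero] at this
        simpa using this
      rw [dist_eq_norm, h4, sub_zero] at this
      exact this.le)
  refine ⟨w, hw, fun s t h0 h1 h2 => ?_⟩
  rw [← rpow_one_div_half (hw.nonneg s t)]
  exact h s t h0 h1 h2

/-- The remainder is small near the diagonal because Y and X are continuous and Y' is bounded, so
interpolation applies to it as well. The sum of the three controls serves all three bounds. -/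
theorem IsControlledPath.exists_isControl [NormedSpace ℝ F] {X : ℝ → EuclideanSpace ℝ (Fin d)}
    (hX : IsVariationPath p T X) {Y : ℝ → F} {Y' : ℝ → EuclideanSpace ℝ (Fin d) →L[ℝ] F}
    (hY : IsControlledPath p T X Y Y') (hp : 0 < p) (hpq : p < q) :
    ∃ w, IsControl T w ∧ ∀ s t, 0 ≤ s → s ≤ t → t ≤ T →
      ‖pathIncrement Y s t‖ ≤ w s t ^ (1 / q) ∧ ‖pathIncrement Y' s t‖ ≤ w s t ^ (1 / q) ∧
      ‖controlledRemainder X Y Y' s t‖ ≤ (w s t ^ (1 / q)) ^ 2 := by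
  have hq0 : 0 ≤ 1 / q := (one_div_pos.2 (hp.trans hpq)).le
  obtain ⟨w₁, hw₁, h₁⟩ := hY.path.exists_isControl hp hpq
  obtain ⟨w₂, hw₂, h₂⟩ := hY.deriv.exists_isControl hp hpq
  obtain ⟨N, hN⟩ := isCompact_Icc.exists_bound_of_continuousOn hY.deriv.continuousOn
  obtain ⟨w₃, hw₃, h₃⟩ := exists_isControl_of_pVariation (α := p / 2) (β := q / 2) (by linarith)
    (by linarith) hY.remainder (by
      intro ε hε
      obtain ⟨δ₁, hδ₁, h₁⟩ := norm_pathIncrement_small hY.path.continuousOn (ε / 2) (by linarith)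
      obtain ⟨δ₂, hδ₂, h₂⟩ := norm_pathIncrement_small hX.continuousOn (ε / (2 * (|N| + 1)))
        (by positivity)
      refine ⟨min δ₁ δ₂, lt_min hδ₁ hδ₂, fun s t h0 h1 h2 h3 => ?_⟩
      have e1 := h₁ s t h0 h1 h2 (h3.trans_le (min_le_left _ _))
      have e2 := h₂ s t h0 h1 h2 (h3.trans_le (min_le_right _ _))
      have e3 : ‖Y' s (pathIncrement X s t)‖ ≤ (|N| + 1) * (ε / (2 * (|N| + 1))) := by
        refine (ContinuousLinearMap.le_opNorm _ _).trans
          (mul_le_mul ?_ e2 (norm_nonneg _) (by positivity))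
        linarith [hN s ⟨h0, h1.trans h2⟩, le_abs_self N]
      have e4 : (|N| + 1) * (ε / (2 * (|N| + 1))) = ε / 2 := by
        have : |N| + 1 ≠ 0 := by positivity
        field_simp
      refine (norm_sub_le _ _).trans ?_
      linarith)
  refine ⟨_, (hw₁.add hw₂).add hw₃, fun s t h0 h1 h2 => ⟨?_, ?_, ?_⟩⟩
  · refine (h₁ s t h0 h1 h2).trans (Real.rpow_le_rpow (hw₁.nonneg s t) ?_ hq0)
    linarith [hw₂.nonneg s t, hw₃.nonneg s t]
  · refine (h₂ s t h0 h1 h2).trans (Real.rpow_le_rpow (hw₂.nonneg s t) ?_ hq0)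
    linarith [hw₁.nonneg s t, hw₃.nonneg s t]
  · refine (h₃ s t h0 h1 h2).trans ?_
    rw [rpow_one_div_half (hw₃.nonneg s t)]
    refine pow_le_pow_left₀ (Real.rpow_nonneg (hw₃.nonneg s t) _)
      (Real.rpow_le_rpow (hw₃.nonneg s t) ?_ hq0) 2
    linarith [hw₁.nonneg s t, hw₂.nonneg s t]

/-- Needed because the path obtained by compactness is a pointwise limit along an ultrafilter; its
continuity comes only from the bound on its increments. -/
theorem IsControl.continuousOn {w : ℝ → ℝ → ℝ} (hw : IsControl T w) (hq : 0 < q) {Y : ℝ → F}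
    {K : ℝ} (h : ∀ s t, 0 ≤ s → s ≤ t → t ≤ T → ‖Y t - Y s‖ ≤ K * w s t ^ (1 / q)) :
    ContinuousOn Y (Icc 0 T) := by
  refine UniformContinuousOn.continuousOn (Metric.uniformContinuousOn_iff.2 fun ε hε => ?_)
  obtain ⟨δ, hδ, hd⟩ := hw.small ((ε / (|K| + 1)) ^ q) (by positivity)
  have key : ∀ s t, 0 ≤ s → s ≤ t → t ≤ T → t - s < δ → ‖Y t - Y s‖ < ε := by
    intro s t h0 h1 h2 h3
    have hn := hw.nonneg s t
    have h4 : w s t ^ (1 / q) ≤ ε / (|K| + 1) := by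
      refine (Real.rpow_le_rpow hn (hd s t h0 h1 h2 h3).le (one_div_pos.2 hq).le).trans
        (le_of_eq ?_)
      rw [← Real.rpow_mul (by positivity), mul_one_div_cancel hq.ne', Real.rpow_one]
    calc ‖Y t - Y s‖ ≤ |K| * w s t ^ (1 / q) := (h s t h0 h1 h2).trans (by
          gcongr; exact le_abs_self K)
      _ ≤ |K| * (ε / (|K| + 1)) := by gcongr
      _ < (|K| + 1) * (ε / (|K| + 1)) := by
        have : 0 < ε / (|K| + 1) := by positivity
        gcongr; linarith
      _ = ε := mul_div_cancel₀ _ (by positivity)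
  refine ⟨δ, hδ, fun s hs t ht hst => ?_⟩
  rw [Real.dist_eq] at hst
  rcases le_total s t with hle | hle
  · rw [dist_comm, dist_eq_norm]
    refine key s t hs.1 hle ht.2 ?_
    rwa [abs_sub_comm, abs_of_nonneg (by linarith)] at hst
  · rw [dist_eq_norm]
    refine key t s ht.1 hle hs.2 ?_
    rwa [abs_of_nonneg (by linarith)] at hst

variable {E : Type*} [NormedAddCommGroup E] [NormedSpace ℝ E] {A : ℝ → E →L[ℝ] E}
  {X : ℝ → EuclideanSpace ℝ (Fin d)} {XX : ℝ → ℝ → EuclideanSpace ℝ (Fin d × Fin d)}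
  {S : ℝ → E →L[ℝ] EuclideanSpace ℝ (Fin d) →L[ℝ] E}
  {S' : ℝ → EuclideanSpace ℝ (Fin d) →L[ℝ] E →L[ℝ] EuclideanSpace ℝ (Fin d) →L[ℝ] E}

theorem IsRoughPath.exists_isDominated (hp : 0 < p) (hpq : p < q)
    (hA : MemLp A ∞ (volume.restrict (Icc 0 T))) (hX : IsRoughPath p T X XX)
    (hS : IsControlledPath p T X S S') :
    ∃ w N, IsDominated T q N w A X XX S S' := by
  have hq0 : 0 ≤ 1 / q := (one_div_pos.2 (hp.trans hpq)).le
  obtain ⟨w₁, hw₁, h₁⟩ := hX.path.exists_isControl hp hpq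
  obtain ⟨w₂, hw₂, h₂⟩ := hX.exists_isControl hp hpq
  obtain ⟨w₃, hw₃, h₃⟩ := hS.exists_isControl hX.path hp hpq
  have hw₄ := IsControl.length T
  obtain ⟨N₁, hN₁⟩ := isCompact_Icc.exists_bound_of_continuousOn hS.path.continuousOn
  obtain ⟨N₂, hN₂⟩ := isCompact_Icc.exists_bound_of_continuousOn hS.deriv.continuousOn
  have hle₁ : ∀ s t, w₁ s t ≤ w₁ s t + w₂ s t + w₃ s t + |t - s| := fun s t => by
    linarith [hw₂.nonneg s t, hw₃.nonneg s t, hw₄.nonneg s t]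
  have hle₂ : ∀ s t, w₂ s t ≤ w₁ s t + w₂ s t + w₃ s t + |t - s| := fun s t => by
    linarith [hw₁.nonneg s t, hw₃.nonneg s t, hw₄.nonneg s t]
  have hle₃ : ∀ s t, w₃ s t ≤ w₁ s t + w₂ s t + w₃ s t + |t - s| := fun s t => by
    linarith [hw₁.nonneg s t, hw₂.nonneg s t, hw₄.nonneg s t]
  have hr₁ := fun s t => Real.rpow_le_rpow (hw₁.nonneg s t) (hle₁ s t) hq0
  have hr₂ := fun s t => Real.rpow_le_rpow (hw₂.nonneg s t) (hle₂ s t) hq0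
  have hr₃ := fun s t => Real.rpow_le_rpow (hw₃.nonneg s t) (hle₃ s t) hq0
  exact ⟨fun s t => w₁ s t + w₂ s t + w₃ s t + |t - s|,
    max (max N₁ N₂) (eLpNormEssSup A (volume.restrict (Icc 0 T))).toReal,
  { control := ((hw₁.add hw₂).add hw₃).add hw₄
    chen := hX.chen
    norm_path := fun s t h0 h1 h2 => (h₁ s t h0 h1 h2).trans (hr₁ s t)
    norm_second := fun s t h0 h1 h2 => (h₂ s t h0 h1 h2).trans
      (pow_le_pow_left₀ (Real.rpow_nonneg (hw₂.nonneg s t) _) (hr₂ s t) 2)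
    norm_coeff := fun s t h0 h1 h2 => (h₃ s t h0 h1 h2).1.trans (hr₃ s t)
    norm_deriv := fun s t h0 h1 h2 => (h₃ s t h0 h1 h2).2.1.trans (hr₃ s t)
    norm_remainder := fun s t h0 h1 h2 => (h₃ s t h0 h1 h2).2.2.trans
      (pow_le_pow_left₀ (Real.rpow_nonneg (hw₃.nonneg s t) _) (hr₃ s t) 2)
    length_le := fun s t h0 h1 h2 => by
      linarith [hw₁.nonneg s t, hw₂.nonneg s t, hw₃.nonneg s t, le_abs_self (t - s)]
    coeff_le := fun s hs => (hN₁ s hs).trans ((le_max_left _ _).trans (le_max_left _ _))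
    deriv_le := fun s hs => (hN₂ s hs).trans ((le_max_right _ _).trans (le_max_left _ _))
    drift_meas := hA.1
    drift_le := by
      have hfin : eLpNormEssSup A (volume.restrict (Icc 0 T)) ≠ ∞ := by
        rw [← eLpNorm_exponent_top]; exact hA.2.ne
      filter_upwards [ae_le_eLpNormEssSup (f := A) (μ := volume.restrict (Icc 0 T))] with r hr
      refine le_trans ?_ (le_max_right _ _)
      rw [← toReal_enorm]
      exact ENNReal.toReal_mono hfin hr }⟩

end ControlsOfPaths

/-! ### Local expansions of solutions -/

theorem IntervalPartition.exists_fine {s t : ℝ} (hst : s ≤ t) {δ : ℝ} (hδ : 0 < δ) :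
    ∃ π : IntervalPartition s t, ∀ i < π.n, π.pt (i + 1) - π.pt i < δ := by
  obtain ⟨τ, N, h1, h2, h3, -, h5⟩ := exists_fine_sequence hst hδ
  exact ⟨⟨N, τ, h2, h3, fun i _ => h1 (Nat.le_succ i)⟩, h5⟩

section Integral

variable {d : ℕ} {F : Type*} [NormedAddCommGroup F] [NormedSpace ℝ F] {T θ C : ℝ}
  {X : ℝ → EuclideanSpace ℝ (Fin d)} {XX : ℝ → ℝ → EuclideanSpace ℝ (Fin d × Fin d)}
  {Y : ℝ → EuclideanSpace ℝ (Fin d) →L[ℝ] F}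
  {Y' : ℝ → EuclideanSpace ℝ (Fin d) →L[ℝ] EuclideanSpace ℝ (Fin d) →L[ℝ] F}

theorem HasRoughIntegral.eq_zero {a : ℝ} {I : F} (h : HasRoughIntegral X XX Y Y' a a I) :
    I = 0 := by
  rw [← norm_le_zero_iff]
  refine le_of_forall_pos_le_add fun ε hε => ?_
  obtain ⟨δ, -, hd⟩ := h ε hε
  have := hd ⟨0, fun _ => a, rfl, rfl, fun i hi => absurd hi (Nat.not_lt_zero i)⟩
    (fun i hi => absurd hi (Nat.not_lt_zero i))
  simp only [Finset.range_zero, Finset.sum_empty, zero_sub, norm_neg] at this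
  linarith

/-- The increment of a rough integral agrees with its germ up to the error of the sewing lemma. -/
theorem HasRoughIntegral.norm_sub_germ_le {w : ℝ → ℝ → ℝ} (hw : IsSuperadditive T w) (hθ : 1 < θ)
    (hC : 0 ≤ C) {Ξ : ℝ → ℝ → F}
    (hΞY : ∀ s ∈ Icc 0 T, ∀ t,
      Ξ s t = Y s (pathIncrement X s t) + bilinearContract (Y' s) (XX s t))
    (hΞ0 : ∀ s ∈ Icc 0 T, Ξ s s = 0)
    (hΞ : ∀ s r t, 0 ≤ s → s ≤ r → r ≤ t → t ≤ T → ‖Ξ s r + Ξ r t - Ξ s t‖ ≤ C * w s t ^ θ)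
    {s t : ℝ} (h0 : 0 ≤ s) (h1 : s ≤ t) (h2 : t ≤ T) {I I' : F}
    (hI : HasRoughIntegral X XX Y Y' 0 s I) (hI' : HasRoughIntegral X XX Y Y' 0 t I') :
    ‖I' - I - Ξ s t‖ ≤ 2 * C / (1 - 2 ^ (1 - θ)) * w s t ^ θ := by
  refine le_of_forall_pos_le_add fun ε hε => ?_
  obtain ⟨δ, hδ, hd⟩ := hI (ε / 2) (by linarith)
  obtain ⟨δ', hδ', hd'⟩ := hI' (ε / 2) (by linarith)
  -- The sum over `π` approximates `I` and the sum over `π` followed by `ρ` approximates `I'`. Their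
  -- difference is the sum over `ρ`, which additive sewing compares with the germ on [s, t].
  obtain ⟨π, hπ⟩ := IntervalPartition.exists_fine h0 (lt_min hδ hδ')
  obtain ⟨ρ, hρ⟩ := IntervalPartition.exists_fine h1 (lt_min hδ hδ')
  have e1 := hd π fun i hi => (hπ i hi).trans_le (min_le_left _ _)
  have e2 := hd' (π.trans ρ) (π.trans_mesh ρ
    (fun i hi => (hπ i hi).trans_le (min_le_right _ _))
    (fun i hi => (hρ i hi).trans_le (min_le_right _ _)))
  rw [π.sum_trans ρ fun x y =>
    Y x (pathIncrement X x y) + bilinearContract (Y' x) (XX x y)] at e2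
  have hm : ∀ k, ρ.clamp k ∈ Icc 0 T := fun k =>
    ⟨h0.trans (ρ.clamp_mem k).1, (ρ.clamp_mem k).2.trans h2⟩
  have e3 : ∑ i ∈ Finset.range ρ.n, (Y (ρ.pt i) (pathIncrement X (ρ.pt i) (ρ.pt (i + 1))) +
      bilinearContract (Y' (ρ.pt i)) (XX (ρ.pt i) (ρ.pt (i + 1)))) =
      ∑ i ∈ Finset.range ρ.n, Ξ (ρ.clamp i) (ρ.clamp (i + 1)) := by
    rw [ρ.sum_clamp fun x y => Y x (pathIncrement X x y) + bilinearContract (Y' x) (XX x y)]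
    exact Finset.sum_congr rfl fun i _ => (hΞY _ (hm i) _).symm
  rw [e3] at e2
  have e4 := norm_sum_sub_le_of_almost_additive hw hθ hC hΞ0 hΞ ρ.monotone_clamp hm ρ.n 0
  simp only [zero_add, ρ.clamp_zero, ρ.clamp_n] at e4
  generalize ∑ i ∈ Finset.range ρ.n, Ξ (ρ.clamp i) (ρ.clamp (i + 1)) = b at *
  generalize ∑ i ∈ Finset.range π.n, (Y (π.pt i) (pathIncrement X (π.pt i) (π.pt (i + 1))) +
      bilinearContract (Y' (π.pt i)) (XX (π.pt i) (π.pt (i + 1)))) = a at *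
  have e5 : I' - I - Ξ s t = (b - Ξ s t) + (a - I) - (a + b - I') := by abel
  rw [e5]
  have := norm_sub_le ((b - Ξ s t) + (a - I)) (a + b - I')
  have := norm_add_le (b - Ξ s t) (a - I)
  linarith

end Integral

/-! ### Existence and uniqueness of solutions -/

section Solutions

set_option maxSynthPendingDepth 3

variable {n d : ℕ} {p q T N : ℝ} {w : ℝ → ℝ → ℝ} {v : EuclideanSpace ℝ (Fin n)}
  {A : ℝ → EuclideanSpace ℝ (Fin n) →L[ℝ] EuclideanSpace ℝ (Fin n)}
  {X : ℝ → EuclideanSpace ℝ (Fin d)} {XX : ℝ → ℝ → EuclideanSpace ℝ (Fin d × Fin d)}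
  {S : ℝ → EuclideanSpace ℝ (Fin n) →L[ℝ] EuclideanSpace ℝ (Fin d) →L[ℝ] EuclideanSpace ℝ (Fin n)}
  {S' : ℝ → EuclideanSpace ℝ (Fin d) →L[ℝ] EuclideanSpace ℝ (Fin n) →L[ℝ]
    EuclideanSpace ℝ (Fin d) →L[ℝ] EuclideanSpace ℝ (Fin n)}
  {V : ℝ → EuclideanSpace ℝ (Fin n)}
  {V' : ℝ → EuclideanSpace ℝ (Fin d) →L[ℝ] EuclideanSpace ℝ (Fin n)}

theorem roughStep_apply_eq_germ {s t : ℝ} (hV : V' s = prodPath S V s) :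
    roughStep X XX S S' s t (V s) = prodPath S V s (pathIncrement X s t) +
      bilinearContract (prodPathDeriv S S' V V' s) (XX s t) := by
  rw [roughStep, add_apply, secondLevel_apply, prodPathDeriv, hV]
  rfl

/-- The integral equation for a path with the correct local expansion. -/
theorem hasRoughIntegral_of_expansion (hw : IsControl T w) {θ C : ℝ} (hθ : 1 < θ)
    (hV' : ∀ t ∈ Icc 0 T, V' t = prodPath S V t)
    (hint : ∀ s ∈ Icc 0 T, ∀ t ∈ Icc 0 T, IntervalIntegrable (fun r => A r (V r)) volume s t)
    (hexp : ∀ s t, 0 ≤ s → s ≤ t → t ≤ T →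
      ‖V t - V s - roughStep X XX S S' s t (V s) - ∫ r in s..t, A r (V r)‖ ≤ C * w s t ^ θ)
    {t : ℝ} (ht : t ∈ Icc 0 T) :
    HasRoughIntegral X XX (prodPath S V) (prodPathDeriv S S' V V') 0 t
      (V t - V 0 - ∫ r in (0 : ℝ)..t, A r (V r)) := by
  intro ε hε
  obtain ⟨δ, hδ, h⟩ := hw.sum_rpow_small hθ C hε
  refine ⟨δ, hδ, fun π hπ => ?_⟩
  have hm : ∀ k, π.clamp k ∈ Icc 0 T := fun k =>
    ⟨(π.clamp_mem k).1, (π.clamp_mem k).2.trans ht.2⟩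
  have hmono := fun i => π.monotone_clamp (Nat.le_succ i)
  rw [π.sum_clamp fun x y => prodPath S V x (pathIncrement X x y) +
    bilinearContract (prodPathDeriv S S' V V' x) (XX x y)]
  have h1 : ∑ i ∈ Finset.range π.n, (V (π.clamp (i + 1)) - V (π.clamp i)) = V t - V 0 := by
    rw [Finset.sum_range_sub fun i => V (π.clamp i), π.clamp_n, π.clamp_zero]
  have h2 : ∑ i ∈ Finset.range π.n, (∫ r in π.clamp i..π.clamp (i + 1), A r (V r)) =
      ∫ r in (0 : ℝ)..t, A r (V r) := by
    rw [intervalIntegral.sum_integral_adjacent_intervals fun k _ => hint _ (hm k) _ (hm (k + 1)),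
      π.clamp_n, π.clamp_zero]
  -- The proposed value of the integral is itself a sum over the partition, so the difference is a
  -- sum of expansion errors, each at most C w^θ.
  rw [← h1, ← h2, ← Finset.sum_sub_distrib, ← Finset.sum_sub_distrib]
  refine (norm_sum_le _ _).trans_lt (lt_of_le_of_lt (Finset.sum_le_sum fun i _ => ?_)
    (h π.clamp π.n π.monotone_clamp hm fun i hi => ?_))
  · rw [← roughStep_apply_eq_germ (hV' _ (hm i)), ← norm_neg]
    refine le_trans (le_of_eq ?_) (hexp _ _ (hm i).1 (hmono i) (hm (i + 1)).2)
    congr 1; abel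
  · rw [π.clamp_of_le hi.le, π.clamp_of_le (Nat.succ_le_of_lt hi)]
    exact hπ i hi

namespace IsDominated

/-- A path following the one-step maps of the equation up to errors of order three has the local
expansion of a solution. -/
theorem exists_expansion (h : IsDominated T q N w A X XX S S') (hT : 0 ≤ T) (hq : 2 ≤ q)
    (hq3 : q < 3) (v : EuclideanSpace ℝ (Fin n)) :
    ∃ (V : ℝ → EuclideanSpace ℝ (Fin n)) (M K C : ℝ), V 0 = v ∧ ContinuousOn V (Icc 0 T) ∧
      0 ≤ M ∧ 0 ≤ K ∧ 0 ≤ C ∧ (∀ t, ‖V t‖ ≤ M) ∧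
      ∀ s t, 0 ≤ s → s ≤ t → t ≤ T → ‖V t - V s‖ ≤ K * w s t ^ (1 / q) ∧
        ‖V t - V s - roughStep X XX S S' s t (V s) - ∫ r in s..t, A r (V r)‖ ≤
          C * w s t ^ (3 / q) := by
  have hq0 : 0 < q := by linarith
  have hθ : 1 < 3 / q := (one_lt_div hq0).2 hq3
  obtain ⟨V, M, C, hV0, hM, hC⟩ := (h.isAlmostMultiplicative hT hq).exists_path
    h.control.toIsSuperadditive hT hθ v
  have hM0 : 0 ≤ M := (norm_nonneg _).trans (hM 0)
  obtain ⟨B, hB0, hB⟩ := h.norm_rdeStep_sub_one_le hT hq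
  set U := w 0 T ^ (3 / q - 1 / q) with hU
  have hU0 : 0 ≤ U := Real.rpow_nonneg (h.control.nonneg _ _) _
  have hVK : ∀ s t, 0 ≤ s → s ≤ t → t ≤ T → ‖V t - V s‖ ≤ (|C| * U + B * M) * w s t ^ (1 / q) := by
    intro s t h0 h1 h2
    have hx := h.scale_nonneg s t
    have e : V t - V s = (V t - rdeStep A X XX S S' s t (V s)) +
        (rdeStep A X XX S S' s t - 1) (V s) := by simp
    have e1 : ‖(rdeStep A X XX S S' s t - 1) (V s)‖ ≤ B * w s t ^ (1 / q) * M :=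
      (ContinuousLinearMap.le_opNorm _ _).trans
        (mul_le_mul (hB s t h0 h1 h2) (hM s) (norm_nonneg _) (by positivity))
    have e2 : C * w s t ^ (3 / q) ≤ |C| * (U * w s t ^ (1 / q)) :=
      mul_le_mul (le_abs_self C) (rpow_le_mul_rpow (h.control.nonneg s t)
        (h.control.mono le_rfl h0 h1 h2 le_rfl) (by positivity) (by gcongr; norm_num))
        (Real.rpow_nonneg (h.control.nonneg s t) _) (abs_nonneg C)
    rw [e]
    refine (norm_add_le _ _).trans ((add_le_add ((hC s t h0 h1 h2).trans e2) e1).trans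
      (le_of_eq ?_))
    ring
  have hcont : ContinuousOn V (Icc 0 T) := h.control.continuousOn hq0 hVK
  obtain ⟨D, hD⟩ := h.norm_integral_sub_le hT hq (by positivity) hcont (fun t _ => hM t) hVK
  refine ⟨V, M, |C| * U + B * M, |C| + |D|, hV0, hcont, hM0, by positivity, by positivity, hM,
    fun s t h0 h1 h2 => ⟨hVK s t h0 h1 h2, ?_⟩⟩
  have hx := Real.rpow_nonneg (h.control.nonneg s t) (3 / q)
  have e : V t - V s - roughStep X XX S S' s t (V s) - ∫ r in s..t, A r (V r) =
      (V t - rdeStep A X XX S S' s t (V s)) -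
        ((∫ r in s..t, A r (V r)) - (∫ r in s..t, A r) (V s)) := by
    simp only [rdeStep, add_apply, one_apply_eq_self]
    abel
  rw [e, add_mul]
  exact (norm_sub_le _ _).trans (add_le_add
    ((hC s t h0 h1 h2).trans (mul_le_mul_of_nonneg_right (le_abs_self C) hx))
    ((hD s t h0 h1 h2).trans (mul_le_mul_of_nonneg_right (le_abs_self D) hx)))

/-- A path with the local expansion of a solution is controlled. -/
theorem isControlledPath_of_expansion (h : IsDominated T q N w A X XX S S') (hT : 0 ≤ T)
    (hp : 2 ≤ p) (hq : 2 ≤ q) (hq3 : q < 3) (hX : IsRoughPath p T X XX)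
    (hS : IsControlledPath p T X S S') {M C : ℝ} (hM0 : 0 ≤ M) (hC : 0 ≤ C)
    (hcont : ContinuousOn V (Icc 0 T)) (hM : ∀ t, ‖V t‖ ≤ M)
    (hexp : ∀ s t, 0 ≤ s → s ≤ t → t ≤ T →
      ‖V t - V s - roughStep X XX S S' s t (V s) - ∫ r in s..t, A r (V r)‖ ≤
        C * w s t ^ (3 / q)) :
    IsControlledPath p T X V (prodPath S V) := by
  have hp0 : 0 < p := by linarith
  have hq0 : 0 < q := by linarith
  have hN := h.bound_nonneg hT
  have hθ : 1 < 3 / q := (one_lt_div hq0).2 hq3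
  have hpi : 0 ≤ 1 / p := (one_div_pos.2 hp0).le
  -- The control `w` yields only q-variation bounds with q possibly larger than p. The exact
  -- exponent is recovered from the p-variations of X and S and the p/2-variation of XX.
  obtain ⟨u₁, hu₁, h₁⟩ := exists_isSuperadditive_of_pVariation hp0 hX.path.finite
  obtain ⟨u₂, hu₂, h₂⟩ := exists_isSuperadditive_of_pVariation (by linarith : 0 < p / 2) hX.finite
  obtain ⟨u₃, hu₃, h₃⟩ := exists_isSuperadditive_of_pVariation hp0 hS.path.finite
  have hw := h.control.toIsSuperadditive
  obtain ⟨u, hu, hu1, hu2, hu3, huw⟩ : ∃ u, IsSuperadditive T u ∧ (∀ s t, u₁ s t ≤ u s t) ∧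
      (∀ s t, u₂ s t ≤ u s t) ∧ (∀ s t, u₃ s t ≤ u s t) ∧ (∀ s t, w s t ≤ u s t) :=
    ⟨_, ((hu₁.add hu₂).add hu₃).add hw,
      fun s t => by linarith [hu₂.nonneg s t, hu₃.nonneg s t, hw.nonneg s t],
      fun s t => by linarith [hu₁.nonneg s t, hu₃.nonneg s t, hw.nonneg s t],
      fun s t => by linarith [hu₁.nonneg s t, hu₂.nonneg s t, hw.nonneg s t],
      fun s t => by linarith [hu₁.nonneg s t, hu₂.nonneg s t, hu₃.nonneg s t]⟩
  set K := d ^ 2 * (N + N * N) with hK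
  have hK0 : 0 ≤ K := by positivity
  set U₁ := u 0 T ^ (1 - 2 / p) with hU₁
  set U₂ := u 0 T ^ (3 / q - 2 / p) with hU₂
  set U₃ := u 0 T ^ (2 / p - 1 / p) with hU₃
  have hU₁0 : 0 ≤ U₁ := Real.rpow_nonneg (hu.nonneg _ _) _
  have hU₂0 : 0 ≤ U₂ := Real.rpow_nonneg (hu.nonneg _ _) _
  have hU₃0 : 0 ≤ U₃ := Real.rpow_nonneg (hu.nonneg _ _) _
  have h2p : 2 / p ≤ 1 := (div_le_one hp0).2 hp
  have hrem : ∀ s t, 0 ≤ s → s ≤ t → t ≤ T → ‖controlledRemainder X V (prodPath S V) s t‖ ≤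
      (C * U₂ + N * M * U₁ + K * M) * u s t ^ (2 / p) := by
    intro s t h0 h1 h2
    have hs : s ∈ Icc 0 T := ⟨h0, h1.trans h2⟩
    have hun := hu.nonneg s t
    have huU := hu.mono le_rfl h0 h1 h2 le_rfl
    -- Expansion error, drift and second level come with exponents 3/q, 1 and 2/p. Since 2/p ≤ 1 <
    -- 3/q, the first two may be lowered to 2/p at the cost of powers of u(0,T).
    have e : controlledRemainder X V (prodPath S V) s t =
        (V t - V s - roughStep X XX S S' s t (V s) - ∫ r in s..t, A r (V r)) +
        (∫ r in s..t, A r (V r)) + secondLevel (S s) (S' s) (XX s t) (V s) := by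
      simp only [roughStep, add_apply, ContinuousLinearMap.flip_apply, controlledRemainder,
        prodPath, pathIncrement]
      abel
    have e1 : ‖V t - V s - roughStep X XX S S' s t (V s) - ∫ r in s..t, A r (V r)‖ ≤
        C * (U₂ * u s t ^ (2 / p)) :=
      (hexp s t h0 h1 h2).trans (mul_le_mul_of_nonneg_left
        ((Real.rpow_le_rpow (hw.nonneg s t) (huw s t) (by positivity)).trans
          (rpow_le_mul_rpow hun huU (by positivity) (h2p.trans hθ.le))) hC)
    have e2 : ‖∫ r in s..t, A r (V r)‖ ≤ N * M * (U₁ * u s t ^ (2 / p)) := by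
      refine (h.norm_integral_le h0 h1 h2 fun r _ => hM r).trans
        (mul_le_mul_of_nonneg_left ?_ (by positivity))
      refine ((h.length_le s t h0 h1 h2).trans (huw s t)).trans ?_
      simpa using rpow_le_mul_rpow hun huU (by positivity : 0 < 2 / p) h2p
    have e3 : ‖secondLevel (S s) (S' s) (XX s t) (V s)‖ ≤ K * u s t ^ (2 / p) * M := by
      refine (ContinuousLinearMap.le_opNorm _ _).trans
        (mul_le_mul ?_ (hM s) (norm_nonneg _) (by positivity))
      refine (h.norm_secondLevel_le hs _).trans (mul_le_mul_of_nonneg_left ?_ hK0)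
      have e4 := h₂ s t h0 h1 h2
      rw [one_div_div] at e4
      exact e4.trans (Real.rpow_le_rpow (hu₂.nonneg s t) (hu2 s t) (by positivity))
    rw [e]
    refine norm_add₃_le.trans ((add_le_add (add_le_add e1 e2) e3).trans (le_of_eq ?_))
    ring
  set L := C * U₂ + N * M * U₁ + K * M with hL
  have hL0 : 0 ≤ L := by positivity
  have hinc : ∀ s t, 0 ≤ s → s ≤ t → t ≤ T →
      ‖pathIncrement V s t‖ ≤ (L * U₃ + N * M) * u s t ^ (1 / p) := by
    intro s t h0 h1 h2
    have hs : s ∈ Icc 0 T := ⟨h0, h1.trans h2⟩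
    have e : pathIncrement V s t =
        controlledRemainder X V (prodPath S V) s t + S s (V s) (pathIncrement X s t) := by
      simp [controlledRemainder, prodPath]
    have e1 := (hrem s t h0 h1 h2).trans (mul_le_mul_of_nonneg_left
      (rpow_le_mul_rpow (hu.nonneg s t) (hu.mono le_rfl h0 h1 h2 le_rfl)
        (by positivity : 0 < 1 / p) (by gcongr; norm_num)) hL0)
    have e2 : ‖S s (V s) (pathIncrement X s t)‖ ≤ N * M * u s t ^ (1 / p) := by
      refine (ContinuousLinearMap.le_opNorm₂ _ _ _).trans ?_
      refine mul_le_mul (mul_le_mul (h.coeff_le s hs) (hM s) (norm_nonneg _) hN) ?_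
        (norm_nonneg _) (by positivity)
      exact (h₁ s t h0 h1 h2).trans (Real.rpow_le_rpow (hu₁.nonneg s t) (hu1 s t) hpi)
    rw [e]
    refine (norm_add_le _ _).trans ((add_le_add e1 e2).trans (le_of_eq ?_))
    ring
  refine ⟨⟨hcont, pVariation_lt_top_of_norm_le hu hp0 hinc⟩,
    ⟨hS.path.continuousOn.clm_apply hcont, pVariation_lt_top_of_norm_le hu hp0
      (C := M + N * (L * U₃ + N * M)) fun s t h0 h1 h2 => ?_⟩,
    pVariation_lt_top_of_norm_le hu (by linarith) (C := L) fun s t h0 h1 h2 => ?_⟩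
  · have hs : s ∈ Icc 0 T := ⟨h0, h1.trans h2⟩
    have e : pathIncrement (prodPath S V) s t =
        pathIncrement S s t (V t) + S s (pathIncrement V s t) := by
      simp [pathIncrement, prodPath]
    have e1 : ‖pathIncrement S s t (V t)‖ ≤ u s t ^ (1 / p) * M :=
      (ContinuousLinearMap.le_opNorm _ _).trans (mul_le_mul ((h₃ s t h0 h1 h2).trans
        (Real.rpow_le_rpow (hu₃.nonneg s t) (hu3 s t) hpi)) (hM t) (norm_nonneg _)
        (Real.rpow_nonneg (hu.nonneg _ _) _))
    have e2 : ‖S s (pathIncrement V s t)‖ ≤ N * ((L * U₃ + N * M) * u s t ^ (1 / p)) :=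
      (ContinuousLinearMap.le_opNorm _ _).trans (mul_le_mul (h.coeff_le s hs) (hinc s t h0 h1 h2)
        (norm_nonneg _) hN)
    rw [e]
    refine (norm_add_le _ _).trans ((add_le_add e1 e2).trans (le_of_eq ?_))
    ring
  · rw [one_div_div]
    exact hrem s t h0 h1 h2

theorem exists_solution (h : IsDominated T q N w A X XX S S') (hT : 0 ≤ T)
    (hp : 2 ≤ p) (hq : 2 ≤ q) (hq3 : q < 3) (hX : IsRoughPath p T X XX)
    (hS : IsControlledPath p T X S S') (v : EuclideanSpace ℝ (Fin n)) :
    ∃ V, IsLinearRDESolution p T v A X XX S S' V (prodPath S V) := by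
  have hθ : 1 < 3 / q := (one_lt_div (by linarith)).2 hq3
  obtain ⟨V, M, K, C, hV0, hcont, hM0, -, hC0, hM, hexp⟩ := h.exists_expansion hT hq hq3 v
  have hexp' := fun s t h0 h1 h2 => (hexp s t h0 h1 h2).2
  refine ⟨V, h.isControlledPath_of_expansion hT hp hq hq3 hX hS hM0 hC0 hcont hM hexp',
    fun _ _ => rfl, fun t ht => ⟨V t - V 0 - ∫ r in (0 : ℝ)..t, A r (V r),
      hasRoughIntegral_of_expansion h.control hθ (fun _ _ => rfl) (fun s hs t ht =>
        h.intervalIntegrable_drift_apply hcont (fun t _ => hM t) hs ht) hexp' ht, ?_⟩⟩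
  rw [← hV0]; abel

/-- Every solution follows the one-step maps of the equation up to errors of order three. -/
theorem norm_solution_sub_step_le (h : IsDominated T q N w A X XX S S') (hT : 0 ≤ T)
    (hp : 2 ≤ p) (hpq : p < q) (hq3 : q < 3) (hX : IsRoughPath p T X XX)
    (hV : IsLinearRDESolution p T v A X XX S S' V V') :
    V 0 = v ∧ ∃ w' C, IsControl T w' ∧ 0 ≤ C ∧ (∀ s t, w s t ≤ w' s t) ∧
      ∀ s t, 0 ≤ s → s ≤ t → t ≤ T →
        ‖V t - rdeStep A X XX S S' s t (V s)‖ ≤ C * w' s t ^ (3 / q) := by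
  have hq0 : 0 < q := by linarith
  have hq2 : 2 ≤ q := by linarith
  have hθ : 1 < 3 / q := (one_lt_div hq0).2 hq3
  have hV0 : V 0 = v := by
    obtain ⟨I, hI, hIV⟩ := hV.equation 0 ⟨le_rfl, hT⟩
    rw [hIV, hI.eq_zero]; simp
  obtain ⟨w₁, hw₁, h₁⟩ := hV.controlled.exists_isControl hX.path (by linarith) hpq
  have hw' := h.control.add hw₁
  have hd := h.mono hq0 hw' fun s t => by linarith [hw₁.nonneg s t]
  set w' : ℝ → ℝ → ℝ := fun s t => w s t + w₁ s t with hw'def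
  have hle₁ : ∀ s t, w₁ s t ^ (1 / q) ≤ w' s t ^ (1 / q) := fun s t =>
    Real.rpow_le_rpow (hw₁.nonneg s t) (by linarith [h.control.nonneg s t])
      (one_div_pos.2 hq0).le
  obtain ⟨M, hM⟩ := isCompact_Icc.exists_bound_of_continuousOn hV.controlled.path.continuousOn
  have hM0 : 0 ≤ M := (norm_nonneg _).trans (hM 0 ⟨le_rfl, hT⟩)
  obtain ⟨B, hB0, hB⟩ := hd.norm_roughStep_le_scale hT hq0
  obtain ⟨D, hD0, hD⟩ := hd.norm_roughStep_defect_le hT hq0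
  obtain ⟨G, hG⟩ := hd.norm_integral_sub_le hT hq2 zero_le_one hV.controlled.path.continuousOn hM
    fun s t h0 h1 h2 => by
      rw [one_mul]; exact (h₁ s t h0 h1 h2).1.trans (hle₁ s t)
  have hN := hd.bound_nonneg hT
  set K := d ^ 2 * (N + N * N) with hK
  have hK0 : 0 ≤ K := by positivity
  have e3 : (3 : ℝ) = (3 : ℕ) := by norm_num
  have hΞ : ∀ s r t, 0 ≤ s → s ≤ r → r ≤ t → t ≤ T →
      ‖roughStep X XX S S' s r (V s) + roughStep X XX S S' r t (V r) -
        roughStep X XX S S' s t (V s)‖ ≤ (D * M + B * (1 + K * M)) * w' s t ^ (3 / q) := by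
    intro s r t h0 h1 h2 h3
    have hs : s ∈ Icc 0 T := ⟨h0, h1.trans (h2.trans h3)⟩
    have hx := hd.scale_nonneg s t
    have m1 := hd.scale_mono hq0 h0 le_rfl h1 h2 h3
    have m2 := hd.scale_mono hq0 h0 h1 h2 le_rfl h3
    -- Inserting J_{s,r} V_s without its drift in place of V_r gives the operator defect of order
    -- three applied to V_s. The correction is a rough step of order one applied to V_r - V_s -
    -- `roughStep` V_s, which has order two because (V, V') is controlled with V' = SV.
    have e : roughStep X XX S S' s r (V s) + roughStep X XX S S' r t (V r) -
        roughStep X XX S S' s t (V s) =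
        (roughStep X XX S S' s r + roughStep X XX S S' r t - roughStep X XX S S' s t +
          roughStep X XX S S' r t * roughStep X XX S S' s r) (V s) +
        roughStep X XX S S' r t (controlledRemainder X V V' s r -
          secondLevel (S s) (S' s) (XX s r) (V s)) := by
      have e' : controlledRemainder X V V' s r - secondLevel (S s) (S' s) (XX s r) (V s) =
          V r - V s - roughStep X XX S S' s r (V s) := by
        simp only [controlledRemainder, hV.deriv_eq s hs, roughStep, add_apply,
          ContinuousLinearMap.flip_apply, prodPath, pathIncrement]
        abel
      rw [e']
      simp only [add_apply, sub_apply, mul_apply_eq_comp, map_sub]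
      abel
    have n1 := (ContinuousLinearMap.le_opNorm _ _).trans
      (mul_le_mul (hD s r t h0 h1 h2 h3) (hM s hs) (norm_nonneg (V s)) (by positivity))
    have n2 : ‖controlledRemainder X V V' s r - secondLevel (S s) (S' s) (XX s r) (V s)‖ ≤
        (1 + K * M) * (w' s t ^ (1 / q)) ^ 2 := by
      have hr := h2.trans h3
      have k1 : ‖controlledRemainder X V V' s r‖ ≤ (w' s t ^ (1 / q)) ^ 2 :=
        (h₁ s r h0 h1 hr).2.2.trans (pow_le_pow_left₀ (Real.rpow_nonneg (hw₁.nonneg _ _) _)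
          ((hle₁ s r).trans m1) 2)
      have k2 : ‖secondLevel (S s) (S' s) (XX s r) (V s)‖ ≤ K * (w' s t ^ (1 / q)) ^ 2 * M :=
        (ContinuousLinearMap.le_opNorm _ _).trans (mul_le_mul ((hd.norm_secondLevel_le hs _).trans
          (mul_le_mul_of_nonneg_left ((hd.norm_second s r h0 h1 hr).trans
            (pow_le_pow_left₀ (hd.scale_nonneg s r) m1 2)) hK0))
          (hM s hs) (norm_nonneg _) (by positivity))
      refine (norm_sub_le _ _).trans ((add_le_add k1 k2).trans (le_of_eq ?_))
      ring
    have n3 := (ContinuousLinearMap.le_opNorm (roughStep X XX S S' r t) _).trans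
      (mul_le_mul ((hB r t (h0.trans h1) h2 h3).trans (mul_le_mul_of_nonneg_left m2 hB0)) n2
        (norm_nonneg _) (by positivity))
    rw [e, e3, ← rpow_one_div_pow (hw'.nonneg s t)]
    refine (norm_add_le _ _).trans ((add_le_add n1 n3).trans (le_of_eq ?_))
    ring
  have hself : ∀ s ∈ Icc 0 T, roughStep X XX S S' s s (V s) = 0 := by
    intro s hs
    have := hd.rdeStep_self hs
    simp only [rdeStep, intervalIntegral.integral_same, add_zero, add_eq_left] at this
    rw [this, zero_apply]
  set P := D * M + B * (1 + K * M) with hP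
  have hP0 : 0 ≤ P := by positivity
  refine ⟨hV0, w', |2 * P / (1 - 2 ^ (1 - 3 / q))| + |G|, hw', by positivity,
    fun s t => by simp only [hw'def]; linarith [hw₁.nonneg s t], fun s t h0 h1 h2 => ?_⟩
  have hs : s ∈ Icc 0 T := ⟨h0, h1.trans h2⟩
  have ht : t ∈ Icc 0 T := ⟨h0.trans h1, h2⟩
  obtain ⟨I, hI, hIV⟩ := hV.equation s hs
  obtain ⟨I', hI', hIV'⟩ := hV.equation t ht
  have hgerm := HasRoughIntegral.norm_sub_germ_le hw'.toIsSuperadditive hθ hP0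
    (Ξ := fun s t => roughStep X XX S S' s t (V s))
    (fun s hs t => roughStep_apply_eq_germ (hV.deriv_eq s hs)) hself hΞ h0 h1 h2 hI hI'
  have hint := fun {a b : ℝ} (ha : a ∈ Icc 0 T) (hb : b ∈ Icc 0 T) =>
    h.intervalIntegrable_drift_apply hV.controlled.path.continuousOn hM ha hb
  have hadd := intervalIntegral.integral_add_adjacent_intervals (hint ⟨le_rfl, hT⟩ hs) (hint hs ht)
  have hx := Real.rpow_nonneg (hw'.nonneg s t) (3 / q)
  have e : V t - rdeStep A X XX S S' s t (V s) = (I' - I - roughStep X XX S S' s t (V s)) +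
      ((∫ r in s..t, A r (V r)) - (∫ r in s..t, A r) (V s)) := by
    have e1 : V t - V s = (∫ r in s..t, A r (V r)) + (I' - I) := by
      rw [hIV', hIV, ← hadd]; abel
    simp only [rdeStep, add_apply, one_apply_eq_self]
    rw [← sub_sub, ← sub_sub, e1]
    abel
  rw [e, add_mul]
  exact (norm_add_le _ _).trans (add_le_add
    (hgerm.trans (mul_le_mul_of_nonneg_right (le_abs_self _) hx))
    ((hG s t h0 h1 h2).trans (mul_le_mul_of_nonneg_right (le_abs_self _) hx)))

theorem solution_unique (h : IsDominated T q N w A X XX S S') (hT : 0 ≤ T)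
    (hp : 2 ≤ p) (hpq : p < q) (hq3 : q < 3) (hX : IsRoughPath p T X XX)
    {W : ℝ → EuclideanSpace ℝ (Fin n)}
    {W' : ℝ → EuclideanSpace ℝ (Fin d) →L[ℝ] EuclideanSpace ℝ (Fin n)}
    (hV : IsLinearRDESolution p T v A X XX S S' V V')
    (hW : IsLinearRDESolution p T v A X XX S S' W W') :
    EqOn W V (Icc 0 T) ∧ EqOn W' V' (Icc 0 T) := by
  have hq0 : 0 < q := by linarith
  have hθ : 1 < 3 / q := (one_lt_div hq0).2 hq3
  obtain ⟨hV0, w₁, C₁, hw₁, hC₁, hle₁, h₁⟩ := h.norm_solution_sub_step_le hT hp hpq hq3 hX hV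
  obtain ⟨hW0, w₂, C₂, hw₂, hC₂, -, h₂⟩ := h.norm_solution_sub_step_le hT hp hpq hq3 hX hW
  -- Both solutions must be measured by one control, which must also dominate the data.
  have hd := h.mono hq0 (hw₁.add hw₂) fun s t => by linarith [hle₁ s t, hw₂.nonneg s t]
  have hzero := (hd.isAlmostMultiplicative hT (by linarith)).eq_zero_of_norm_sub_le hd.control hθ
    (D := fun t => W t - V t) (C := C₂ + C₁) (by simp [hV0, hW0]) (by
      intro s t h0 h1 h2
      have e : W t - V t - rdeStep A X XX S S' s t (W s - V s) =
          (W t - rdeStep A X XX S S' s t (W s)) - (V t - rdeStep A X XX S S' s t (V s)) := by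
        rw [map_sub]; abel
      rw [e, add_mul]
      refine (norm_sub_le _ _).trans (add_le_add ((h₂ s t h0 h1 h2).trans ?_)
        ((h₁ s t h0 h1 h2).trans ?_))
      · exact mul_le_mul_of_nonneg_left (Real.rpow_le_rpow (hw₂.nonneg s t)
          (by linarith [hw₁.nonneg s t]) (by positivity)) hC₂
      · exact mul_le_mul_of_nonneg_left (Real.rpow_le_rpow (hw₁.nonneg s t)
          (by linarith [hw₂.nonneg s t]) (by positivity)) hC₁)
  have hEq : EqOn W V (Icc 0 T) := fun t ht => sub_eq_zero.1 (hzero t ht)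
  refine ⟨hEq, fun t ht => ?_⟩
  rw [hW.deriv_eq t ht, hV.deriv_eq t ht, prodPath, prodPath, hEq ht]

end IsDominated

end Solutions

theorem theorem3p5 {n d : ℕ} (p T : ℝ) (hp : p ∈ Ico (2 : ℝ) 3) (hT : 0 < T)
    (v : EuclideanSpace ℝ (Fin n))
    (A : ℝ → EuclideanSpace ℝ (Fin n) →L[ℝ] EuclideanSpace ℝ (Fin n))
    (hA : MemLp A ∞ (volume.restrict (Icc 0 T)))
    (X : ℝ → EuclideanSpace ℝ (Fin d)) (XX : ℝ → ℝ → EuclideanSpace ℝ (Fin d × Fin d))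
    (hX : IsRoughPath p T X XX)
    (S : ℝ → EuclideanSpace ℝ (Fin n) →L[ℝ]
      EuclideanSpace ℝ (Fin d) →L[ℝ] EuclideanSpace ℝ (Fin n))
    (S' : ℝ → EuclideanSpace ℝ (Fin d) →L[ℝ] EuclideanSpace ℝ (Fin n) →L[ℝ]
      EuclideanSpace ℝ (Fin d) →L[ℝ] EuclideanSpace ℝ (Fin n))
    (hS : IsControlledPath p T X S S') :
    ∃ (V : ℝ → EuclideanSpace ℝ (Fin n))
      (V' : ℝ → EuclideanSpace ℝ (Fin d) →L[ℝ] EuclideanSpace ℝ (Fin n)),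
      IsLinearRDESolution p T v A X XX S S' V V' ∧
      ∀ (W : ℝ → EuclideanSpace ℝ (Fin n))
        (W' : ℝ → EuclideanSpace ℝ (Fin d) →L[ℝ] EuclideanSpace ℝ (Fin n)),
        IsLinearRDESolution p T v A X XX S S' W W' →
        EqOn W V (Icc 0 T) ∧ EqOn W' V' (Icc 0 T) := by
  obtain ⟨hp2, hp3⟩ := hp
  -- q > p provides controls that are small near the diagonal, and q < 3 makes the sewing exponent
  -- 3/q larger than one.
  obtain ⟨q, hpq, hq3⟩ := exists_between hp3
  obtain ⟨w, N, h⟩ := hX.exists_isDominated (by linarith) hpq hA hS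
  obtain ⟨V, hV⟩ := h.exists_solution hT.le hp2 (by linarith) hq3 hX hS v
  exact ⟨V, prodPath S V, hV, fun W W' hW => h.solution_unique hT.le hp2 hpq hq3 hX hV hW⟩
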